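/- An alcoved polyhedron is a convex body $P\subset\mathbb R^3$ with non-empty interior that is a bounded intersection of half-spaces with bounding planes of the form $x_i=\mathrm{const}$ or $x_i-x_j=\mathrm{const}$. Its $f$-vector $(f_0,f_1,f_2)$ counts vertices, edges and facets. It is called maximal if its $f$-vector is maximal, componentwise, among the $f$-vectors of alcoved polyhedra. Let $\mathcal D$ be the family of maximal alcoved polyhedra. Let $Q=[-1,1]^3$. For $P\in\mathcal D$ let $P_Q$ be the image of $P$ under the affine map $x\mapsto(s_ix_i+v_i)_i$, $s_i>0$, that takes the bounding box of $P$ onto $Q$. Let $\mathcal G_3\cong\mathbb Z_2\times\Sigma_3$ be the group of the twelve symmetries of $Q$ that preserve the diagonal spanned by $(1,1,1)$ (permutations of the coordinates and the antipodal map generate it). For a family $\mathcal F$ of convex bodies with bounding box $Q$, let $\sim_{\mathcal F}$ be the equivalence relation on $\mathcal F$ generated by: $K\sim K'$ if $K'=gK$ for some $g\in\mathcal G_3$; and $K\sim K'$ if $K'$ is obtained from $K$ by small perturbations inside $\mathcal F$, i.e. $K$ and $K'$ are joined by a path in $\mathcal F$ that is continuous for the Hausdorff metric. Two members $P,P'$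 of $\mathcal D$ are quasi-Euclidean equivalent if $P_Q\sim_{\mathcal F}P'_Q$ for $\mathcal F=\{P_Q:P\in\mathcal D\}$. A real $4\times4$ matrix $A=(a_{ij})$ is visualized idempotent if $a_{ij}\le 0$, $a_{ii}=a_{4j}=0$ and $a_{ik}+a_{kj}\le a_{ij}$ for all $i,j,k$. Let $\mathcal P(A)\subset\mathbb R^3=\{x_4=0\}$ be the set of the $x$ with $x_4=0$ and $x_i=\max_k(\lambda_k+a_{ik})$ $(1\le i\le 4)$ for some $\lambda\in\mathbb R^4$. With $e_{ij}=a_{i4}-a_{ij}$ for $i\ne j$ in $\{1,2,3\}$ and $c=(e_{23},e_{13},e_{12},e_{32},e_{31},e_{21})$, the difference tuple of $A$ is $d=(c_{i+1}-c_i)_{i=1}^6$, $c_7=c_1$. Let $\mathbb Z_2\times\Sigma_6$ act on $6$-tuples by sign changes of the whole tuple and permutations of its entries, and let $G_3$ be its subgroup generated by $+(14)(25)(36)$, $-(26)(35)$, $-(15)(24)$, $-(13)(46)$. Let $T$ be the set of non-constant tuples in $\{+,-\}^6$. Theorem. 1. The componentwise greatest $f$-vector of an alcoved polyhedron exists and is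 $(20,30,12)$. Hence every maximal alcoved polyhedron is a dodecahedron with $f$-vector $(20,30,12)$; moreover it is simple (three edges at each vertex). 2. Every $P\in\mathcal D$ is a translate of $\mathcal P(A)$ for a unique visualized idempotent matrix $A$. The entries of the difference tuple $d$ of $A$ are non-zero and do not all have the same sign; so $\operatorname{sign}(d)\in T$. 3. Write $\pm\tau$ for $(\pm1,\tau)$ and $-\mathrm{id}$ for $(-1,\mathrm{id})$. Then $-\mathrm{id}\mapsto +(14)(25)(36)$, $+(12)\mapsto-(26)(35)$, $+(13)\mapsto-(15)(24)$, $+(23)\mapsto-(13)(46)$ defines an isomorphism $\mathbb Z_2\times\Sigma_3\to G_3$. The set $T$ has $62$ elements, and $G_3$ has exactly $8$ orbits on it. 4. There are exactly eight quasi-Euclidean classes in $\mathcal D$, and $P\mapsto\operatorname{sign}(d)$ induces a bijection from the set of classes onto the set of $G_3$-orbits on $T$. 5. The same holds for the family $\mathcal D_Q$ of the $P\in\mathcal D$ whose bounding box is $Q$, with the relation $\sim_{\mathcal D_Q}$ (perturbations inside $\mathcal D_Q$). -/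

import Mathlib

open TopologicalSpace

namespace Alcoved

/-- The space `ℝ³`. Only its linear structure and its topology are used. -/
abbrev Space := Fin 3 → ℝ

/-! Alcoved polyhedra and their faces -/

/-- Homogeneous coordinates: `(x₁, x₂, x₃) ↦ (x₁, x₂, x₃, 0)`. -/
def hom (x : Space) : Fin 4 → ℝ := Fin.snoc x 0

/-- An alcoved polyhedron in `ℝ³`: a convex body which is the intersection of half-spaces bounded
by planes `x_i = const` and `x_i - x_j = const`. With `x₄ = 0`, all the inequalities read
`a i j ≤ x_i - x_j`. (Redundant inequalities are allowed, so a full matrix `a` exists for every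
bounded intersection of such half-spaces.) -/
def IsAlcoved (P : NonemptyCompacts Space) : Prop :=
  (interior (P : Set Space)).Nonempty ∧
    ∃ a : Matrix (Fin 4) (Fin 4) ℝ,
      (P : Set Space) = {x | ∀ i j, a i j ≤ hom x i - hom x j}

/-- The `k`-dimensional (nonempty, exposed) faces of a convex body. For polytopes every face is
exposed. -/
def faces (k : ℕ) (P : NonemptyCompacts Space) : Set (Set Space) :=
  {F | F.Nonempty ∧ IsExposed ℝ (P : Set Space) F ∧ Module.finrank ℝ (vectorSpan ℝ F) = k}

/-- The `f`-vector `(f₀, f₁, f₂)`: numbers of vertices, edges and facets. -/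
noncomputable def fVec (P : NonemptyCompacts Space) : Fin 3 → ℕ∞ :=
  fun k => (faces k P).encard

/-- A polyhedron is simple if it is trivalent in vertices: every vertex lies on exactly three
edges. -/
def IsSimple (P : NonemptyCompacts Space) : Prop :=
  ∀ V ∈ faces 0 P, {e ∈ faces 1 P | V ⊆ e}.encard = 3

/-- The family of maximal alcoved polyhedra: the alcoved polyhedra whose `f`-vector is maximal,
for the componentwise order, among the `f`-vectors of alcoved polyhedra. -/
def maximalAlcoved : Set (NonemptyCompacts Space) :=
  {P | MaximalFor IsAlcoved fVec P}

/-! Bounding boxes and the unit cube `[-1, 1]³` -/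

/-- Least value of the `i`-th coordinate on `P`. -/
noncomputable def lo (P : NonemptyCompacts Space) (i : Fin 3) : ℝ :=
  sInf ((fun x : Space => x i) '' (P : Set Space))

/-- Greatest value of the `i`-th coordinate on `P`. -/
noncomputable def hi (P : NonemptyCompacts Space) (i : Fin 3) : ℝ :=
  sSup ((fun x : Space => x i) '' (P : Set Space))

/-- The affine map that takes the bounding box `∏ [lo P i, hi P i]` of `P` onto the cube
`[-1, 1]³`, preserving the direction of every coordinate axis; that is, taking the generators
(the South Pole and its three neighbours) of the box to the corresponding ones of the cube. -/
noncomputable def boxMap (P : NonemptyCompacts Space) (x : Space) : Space :=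
  fun i => 2 * (x i - lo P i) / (hi P i - lo P i) - 1

theorem continuous_boxMap (P : NonemptyCompacts Space) : Continuous (boxMap P) := by
  unfold boxMap
  fun_prop

/-- The image of `P` under the affine map that turns its bounding box into the cube. -/
noncomputable def toCube (P : NonemptyCompacts Space) : NonemptyCompacts Space :=
  P.map (boxMap P) (continuous_boxMap P)

/-- The maximal alcoved polyhedra whose bounding box is the cube. -/
def maximalInCube : Set (NonemptyCompacts Space) :=
  {P | P ∈ maximalAlcoved ∧ ∀ i, lo P i = -1 ∧ hi P i = 1}

/-- The bodies with bounding box the cube that come from maximal alcoved polyhedra with arbitrary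
bounding box through the affine maps above. -/
def normalizedFamily : Set (NonemptyCompacts Space) :=
  toCube '' maximalAlcoved

/-! Symmetries, perturbations and quasi-Euclidean equivalence -/

/-- The group `𝒢₃ = ℤ₂ × Σ₃`. -/
abbrev CubeGroup := ℤˣ × Equiv.Perm (Fin 3)

/-- The cube symmetry given by `(ε, τ)`: it is orientation preserving for `ε = 1` and reversing
for `ε = -1`, and it permutes the diagonals `1, 2, 3` of the cube according to `τ` and preserves
the fourth one, the Polar Axis. Thus `(-1, 1)` is the antipodal map, `(-1, (i j))` is the
reflection on the plane `x_i = x_j`, and `(1, (i j))` is the half-turn around the line spanned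
by `u_i - u_j`. -/
def cubeSym (g : CubeGroup) (x : Space) : Space :=
  fun i => ((g.1 * Equiv.Perm.sign g.2 : ℤˣ) : ℤ) * x (g.2⁻¹ i)

/-- The equivalence relation generated, on a family `𝓕` of bodies with bounding box the cube, by
the symmetries in `𝒢₃` and by small perturbations. The latter generate the relation of being
joined by a path (for the Hausdorff metric) that remains in `𝓕`. -/
def cubeEquiv (𝓕 : Set (NonemptyCompacts Space)) : Setoid 𝓕 :=
  Relation.EqvGen.setoid fun K L =>
    (∃ g : CubeGroup, ((L : NonemptyCompacts Space) : Set Space) =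
      cubeSym g '' ((K : NonemptyCompacts Space) : Set Space)) ∨
    JoinedIn 𝓕 (K : NonemptyCompacts Space) (L : NonemptyCompacts Space)

/-- Quasi-Euclidean equivalence of maximal alcoved polyhedra: bring both bounding boxes to the
cube by the affine maps, and compare the resulting bodies. -/
noncomputable def quasiEuclidean : Setoid maximalAlcoved :=
  (cubeEquiv normalizedFamily).comap fun P => ⟨toCube P, Set.mem_image_of_mem toCube P.2⟩

/-! Visualized idempotent matrices and difference tuples -/

/-- Normal (tropically) idempotent matrices of order four. -/
structure IsNormalIdempotent (A : Matrix (Fin 4) (Fin 4) ℝ) : Prop where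
  nonpos : ∀ i j, A i j ≤ 0
  diag : ∀ i, A i i = 0
  idem : ∀ i j k, A i k + A k j ≤ A i j

/-- Visualized idempotent matrices: the last row is zero. -/
structure IsVisualizedIdempotent (A : Matrix (Fin 4) (Fin 4) ℝ) : Prop
    extends IsNormalIdempotent A where
  lastRow : ∀ j, A 3 j = 0

/-- `𝒫(A)`: the intersection of the tropical (max-plus) span of the columns of `A` with
`{x₄ = 0} = ℝ³`. -/
def tropicalSection (A : Matrix (Fin 4) (Fin 4) ℝ) : Set Space :=
  {x | ∃ w : Fin 4 → ℝ, ∀ i, hom x i = ⨆ k, (w k + A i k)}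

/-- `A` is a visualized idempotent matrix of `P`: a translate of `P` is `𝒫(A)`. -/
def Represents (A : Matrix (Fin 4) (Fin 4) ℝ) (P : NonemptyCompacts Space) : Prop :=
  IsVisualizedIdempotent A ∧ ∃ v : Space, (P : Set Space) = (fun x => v + x) '' tropicalSection A

/-- The perturbation matrix `E = B - A`, where `B` is the bounding box matrix of `A`. -/
def perturbationMatrix (A : Matrix (Fin 4) (Fin 4) ℝ) : Matrix (Fin 4) (Fin 4) ℝ :=
  !![0, A 0 3, A 0 3, A 0 3;
     A 1 3, 0, A 1 3, A 1 3;
     A 2 3, A 2 3, 0, A 2 3;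
     0, 0, 0, 0] - A

/-- The cant tuple `(e₂₃, e₁₃, e₁₂, e₃₂, e₃₁, e₂₁)`. -/
def cant (A : Matrix (Fin 4) (Fin 4) ℝ) : Fin 6 → ℝ :=
  ![perturbationMatrix A 1 2, perturbationMatrix A 0 2, perturbationMatrix A 0 1,
    perturbationMatrix A 2 1, perturbationMatrix A 2 0, perturbationMatrix A 1 0]

/-- The difference tuple `d_i = c_{i+1} - c_i`, with indices modulo six. -/
def difference (A : Matrix (Fin 4) (Fin 4) ℝ) : Fin 6 → ℝ :=
  fun i => cant A (i + 1) - cant A i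

/-! Sign tuples and the group `G₃` -/

/-- The non-constant 6-tuples of signs. -/
def SignTuple := {s : Fin 6 → ℤˣ // ¬ ∀ i j, s i = s j}

/-- The natural action of `ℤ₂ × Σ₆`: permute the entries and multiply by a sign. -/
instance : MulAction (ℤˣ × Equiv.Perm (Fin 6)) SignTuple where
  smul g s := ⟨fun i => g.1 * s.1 (g.2⁻¹ i), fun h => s.2 fun i j => by
    simpa using h (g.2 i) (g.2 j)⟩
  one_smul s := Subtype.ext (funext fun i => by
    change (1 : ℤˣ) * s.1 ((1 : Equiv.Perm (Fin 6))⁻¹ i) = s.1 i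
    simp)
  mul_smul g h s := Subtype.ext (funext fun i => by
    change (g.1 * h.1) * s.1 ((g.2 * h.2)⁻¹ i) = g.1 * (h.1 * s.1 (h.2⁻¹ (g.2⁻¹ i)))
    simp [mul_assoc])

/-- The entries of the difference tuple of `A` are nonzero and have the signs `s`. -/
def HasSigns (A : Matrix (Fin 4) (Fin 4) ℝ) (s : SignTuple) : Prop :=
  ∀ i, 0 < (((s.1 i : ℤˣ) : ℤ) : ℝ) * difference A i

open Equiv in
/-- `+(14)(25)(36)` (indices are shifted by one: `Fin 6` starts at zero). -/
def genAntipodal : ℤˣ × Perm (Fin 6) := (1, swap 0 3 * swap 1 4 * swap 2 5)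

open Equiv in
/-- `-(26)(35)`. -/
def gen12 : ℤˣ × Perm (Fin 6) := (-1, swap 1 5 * swap 2 4)

open Equiv in
/-- `-(15)(24)`. -/
def gen13 : ℤˣ × Perm (Fin 6) := (-1, swap 0 4 * swap 1 3)

open Equiv in
/-- `-(13)(46)`. -/
def gen23 : ℤˣ × Perm (Fin 6) := (-1, swap 0 2 * swap 3 5)

/-- The subgroup `G₃` of `ℤ₂ × Σ₆`. -/
def signGroup : Subgroup (ℤˣ × Equiv.Perm (Fin 6)) :=
  Subgroup.closure {genAntipodal, gen12, gen13, gen23}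

/-- The orbits of `G₃` on non-constant sign tuples. -/
abbrev SignOrbits := MulAction.orbitRel.Quotient signGroup SignTuple

/-- The orbit of a sign tuple. -/
def orbitOf (s : SignTuple) : SignOrbits := Quotient.mk _ s

end Alcoved

open Alcoved

/-!
Write `x₄ = 0`. After tightening its inequalities, an alcoved polyhedron is
`body a = {x | a i j ≤ x_i - x_j}` for a unique matrix `a` with zero diagonal that satisfies the
triangle inequalities (`IsKleene`); translations add coboundaries to `a`, and the visualized
idempotent matrix is the one whose last row vanishes.

**Faces.** A nonempty exposed face is determined by the set of inequalities tight at a point of its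
relative interior, and its direction is the space `dir` of vectors constant along these arcs, so
its dimension is one less than the number of connected components of the graph (`mem_faces`). By
the triangle inequality, tight arcs compose: they form a strict partial order on the four indices.
A connected order on four elements contains a spanning star or a zigzag path in the complete
bipartite graph between two rows and two columns. Such a path misses one arc of the bipartite
graph, and feasibility forces this arc to lie in the smaller one of the two perfect matchings. This
leaves `4 + 4 + 6 * 2 = 20` labels for vertices; likewise there are `12 + 12 + 6 = 30` for edges
and `12` for facets (`IsAlcoved.fVec_le`). All labels are realized if the triangle inequalities are
strict and the six tropical minors avoiding the diagonal do not vanish (`IsGeneric.fVec_eq`).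
Conversely, an equality in a triangle inequality costs a facet and a vanishing minor costs a
vertex, so the maximal alcoved polyhedra are exactly those of generic matrices
(`mem_maximalAlcoved_iff`). The six minors form the difference tuple; they sum to zero, so their
signs are not all equal.

**Classes.** For fixed signs of the minors, the generic matrices form a convex set, described by
strict linear inequalities. The body is the image of a fixed box under a tropical linear map that
depends continuously on the matrix, so the segment between two matrices yields a path of normalized
bodies (`joinedIn_of_signs`). Conversely, the sign of a minor can be read off the normalized body:
it compares the greatest values of one coordinate on two facets of the cube. These values are
continuous on the family (`continuousOn_facetMax`), and the comparisons never vanish, so the signs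
are constant along paths (`BodySigns.eq_of_joinedIn`). A symmetry of the cube permutes the signed
coordinates, and an odd permutation of the axes exchanges the two facets compared; so the
symmetries act on the signs through `signHom`, whose range is the group of the theorem
(`range_signHom`). Therefore the classes are the orbits of sign tuples, for every family of generic
matrices that is stable under the symmetries, convex, and realizes all signs
(`IsAdmissible.exists_equiv`).
-/

namespace Alcoved

/-! ### Homogeneous coordinates and Kleene matrices -/

@[simp] theorem hom_three (x : Space) : hom x 3 = 0 := rfl
@[simp] theorem hom_zero (x : Space) : hom x 0 = x 0 := rfl
@[simp] theorem hom_one (x : Space) : hom x 1 = x 1 := rfl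
@[simp] theorem hom_two (x : Space) : hom x 2 = x 2 := rfl

@[simp] theorem hom_castSucc (x : Space) (i : Fin 3) : hom x i.castSucc = x i := by
  simp [hom]

theorem hom_add (x y : Space) (i : Fin 4) : hom (x + y) i = hom x i + hom y i := by
  fin_cases i <;> simp

theorem hom_sub (x y : Space) (i : Fin 4) : hom (x - y) i = hom x i - hom y i := by
  fin_cases i <;> simp

theorem hom_smul (c : ℝ) (x : Space) (i : Fin 4) : hom (c • x) i = c * hom x i := by
  fin_cases i <;> simp

theorem continuous_hom (i : Fin 4) : Continuous fun x => hom x i := by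
  fin_cases i <;> simp <;> fun_prop

/-- The point of `ℝ³` with the given homogeneous coordinates, which are defined up to a common
additive constant. -/
def ofHom (y : Fin 4 → ℝ) : Space := fun i => y i.castSucc - y 3

theorem hom_ofHom (y : Fin 4 → ℝ) (i : Fin 4) : hom (ofHom y) i = y i - y 3 := by
  fin_cases i <;> simp [ofHom]

theorem ofHom_hom (x : Space) : ofHom (hom x) = x := by
  funext i; simp [ofHom]

/-- The polyhedron cut out by the inequalities `a i j ≤ x_i - x_j`. -/
def body (a : Matrix (Fin 4) (Fin 4) ℝ) : Set Space := {x | ∀ i j, a i j ≤ hom x i - hom x j}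

theorem mem_body {a : Matrix (Fin 4) (Fin 4) ℝ} {x : Space} :
    x ∈ body a ↔ ∀ i j, a i j ≤ hom x i - hom x j := Iff.rfl

theorem isCompact_body (a : Matrix (Fin 4) (Fin 4) ℝ) : IsCompact (body a) := by
  have hcl : IsClosed (body a) := by
    simp only [body, Set.ofPred_forall]
    exact isClosed_iInter fun i => isClosed_iInter fun j =>
      isClosed_le continuous_const ((continuous_hom i).sub (continuous_hom j))
  refine (isCompact_Icc (a := fun i : Fin 3 => a i.castSucc 3)
    (b := fun i : Fin 3 => - a 3 i.castSucc)).of_isClosed_subset hcl fun x hx =>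
      ⟨fun i => ?_, fun i => ?_⟩
  · simpa using hx i.castSucc 3
  · have := hx 3 i.castSucc
    simp at this
    simp only
    linarith

/-- Kleene matrices: the matrices with zero diagonal satisfying the triangle inequalities, i.e. the
tight systems of inequalities. -/
structure IsKleene (a : Matrix (Fin 4) (Fin 4) ℝ) : Prop where
  diag : ∀ i, a i i = 0
  idem : ∀ i j k, a i k + a k j ≤ a i j

/-- Generic Kleene matrices: the triangle inequalities are strict unless trivial, and no tropical
minor of order two without diagonal entries vanishes. -/
structure IsGeneric (a : Matrix (Fin 4) (Fin 4) ℝ) : Prop where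
  diag : ∀ i, a i i = 0
  strict : ∀ i j k, i ≠ k → k ≠ j → a i k + a k j < a i j
  minor : ∀ i j k l, i ≠ j → i ≠ k → i ≠ l → j ≠ k → j ≠ l → k ≠ l →
    a i j + a l k ≠ a i k + a l j

theorem IsGeneric.isKleene {a : Matrix (Fin 4) (Fin 4) ℝ} (h : IsGeneric a) : IsKleene a where
  diag := h.diag
  idem i j k := by
    rcases eq_or_ne i k with rfl | hik
    · simp [h.diag]
    rcases eq_or_ne k j with rfl | hkj
    · simp [h.diag]
    exact (h.strict i j k hik hkj).le

section Kleene

variable {a : Matrix (Fin 4) (Fin 4) ℝ}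

/-- The `j`-th column of a Kleene matrix, as a point of the polyhedron. -/
def colPoint (a : Matrix (Fin 4) (Fin 4) ℝ) (j : Fin 4) : Space := ofHom fun k => a k j

/-- The opposite of the `i`-th row of a Kleene matrix, as a point of the polyhedron. -/
def rowPoint (a : Matrix (Fin 4) (Fin 4) ℝ) (i : Fin 4) : Space := ofHom fun k => - a i k

theorem IsKleene.colPoint_mem (h : IsKleene a) (j : Fin 4) : colPoint a j ∈ body a := fun i k => by
  have := h.idem i j k
  simp only [colPoint, hom_ofHom]; linarith

theorem IsKleene.rowPoint_mem (h : IsKleene a) (i : Fin 4) : rowPoint a i ∈ body a := fun k l => by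
  have := h.idem i l k
  simp only [rowPoint, hom_ofHom]; linarith

theorem IsKleene.hom_colPoint_sub (h : IsKleene a) (i j : Fin 4) :
    hom (colPoint a j) i - hom (colPoint a j) j = a i j := by
  simp only [colPoint, hom_ofHom, h.diag]; ring

/-- The entries of a Kleene matrix are the least values of the functionals `x_i - x_j`. -/
theorem IsKleene.isLeast (h : IsKleene a) (i j : Fin 4) :
    IsLeast ((fun x => hom x i - hom x j) '' body a) (a i j) :=
  ⟨⟨_, h.colPoint_mem j, h.hom_colPoint_sub i j⟩, by rintro _ ⟨x, hx, rfl⟩; exact hx i j⟩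

/-- A convex body has a unique Kleene matrix; translations add coboundaries to it. -/
theorem IsKleene.eq_of_body_eq_translate {A : Matrix (Fin 4) (Fin 4) ℝ} (h : IsKleene a)
    (hA : IsKleene A) {v : Space} (hv : body a = (fun x => v + x) '' body A) (i j : Fin 4) :
    a i j = A i j + (hom v i - hom v j) := by
  refine (h.isLeast i j).unique ⟨⟨v + colPoint A j, hv ▸ ⟨_, hA.colPoint_mem j, rfl⟩, ?_⟩, ?_⟩
  · have := hA.hom_colPoint_sub i j
    simp only [hom_add]; linarith
  · rintro _ ⟨x, hx, rfl⟩
    rw [hv] at hx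
    obtain ⟨y, hy, rfl⟩ := hx
    have := hy i j
    simp only [hom_add]; linarith

end Kleene

/-- Tightening: every alcoved polyhedron is defined by a Kleene matrix without vanishing cycles of
length two. -/
theorem IsAlcoved.exists_isKleene {P : NonemptyCompacts Space} (hP : IsAlcoved P) :
    ∃ a, IsKleene a ∧ (∀ i j, i ≠ j → a i j + a j i < 0) ∧ (P : Set Space) = body a := by
  obtain ⟨⟨x₀, hx₀⟩, b, hb⟩ := hP
  have hmin : ∀ i j, ∃ x ∈ (P : Set Space), ∀ y ∈ (P : Set Space),
      hom x i - hom x j ≤ hom y i - hom y j := fun i j =>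
    P.isCompact.exists_isMinOn P.nonempty
      ((continuous_hom i).sub (continuous_hom j)).continuousOn
  choose p hpP hp using hmin
  refine ⟨fun i j => hom (p i j) i - hom (p i j) j, ⟨fun i => sub_self _, fun i j k => ?_⟩,
    fun i j hij => ?_, ?_⟩
  · have h1 := hp i k _ (hpP i j)
    have h2 := hp k j _ (hpP i j)
    linarith
  · -- a vanishing cycle would put the body inside a plane, moving off it contradicts interiority
    by_contra! hcon
    have heq : ∀ y ∈ (P : Set Space), hom y i - hom y j = hom (p i j) i - hom (p i j) j := by
      intro y hy
      have h1 := hp i j y hy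
      have h2 := hp j i y hy
      linarith
    obtain ⟨v, hv⟩ : ∃ v : Space, hom v i - hom v j = 1 := by
      refine ⟨ofHom (Pi.single i 1), ?_⟩
      simp [hom_ofHom, hij.symm]
    have hc : Continuous fun t : ℝ => x₀ + t • v := by fun_prop
    have h0 : (fun t : ℝ => x₀ + t • v) 0 ∈ interior (P : Set Space) := by simpa using hx₀
    have hnhds := hc.continuousAt.preimage_mem_nhds (isOpen_interior.mem_nhds h0)
    obtain ⟨ε, hε, hball⟩ := Metric.mem_nhds_iff.1 hnhds
    have hm : x₀ + (ε / 2) • v ∈ (P : Set Space) := interior_subset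
      (hball (by simp [abs_of_pos hε, hε] : ε / 2 ∈ Metric.ball (0 : ℝ) ε))
    have e1 := heq _ hm
    have e2 := heq _ (interior_subset hx₀)
    simp only [hom_add, hom_smul] at e1
    nlinarith
  · ext x
    refine ⟨fun hx i j => hp i j x hx, fun hx => ?_⟩
    rw [hb]
    intro i j
    have := hpP i j
    rw [hb] at this
    exact (this i j).trans (hx i j)

/-! ### Faces and systems of tight inequalities -/

/-- The homogeneous coordinates as linear functionals. -/
def homLin (i : Fin 4) : Space →ₗ[ℝ] ℝ where
  toFun x := hom x i
  map_add' x y := hom_add x y i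
  map_smul' c x := hom_smul c x i

@[simp] theorem homLin_apply (i : Fin 4) (x : Space) : homLin i x = hom x i := rfl

/-- The directions along which the inequalities in `T` remain tight. -/
def dir (T : Finset (Fin 4 × Fin 4)) : Submodule ℝ Space where
  carrier := {v | ∀ p ∈ T, hom v p.1 = hom v p.2}
  add_mem' hv hw p hp := by rw [hom_add, hom_add, hv p hp, hw p hp]
  zero_mem' p _ := by simp [← homLin_apply]
  smul_mem' c v hv p hp := by rw [hom_smul, hom_smul, hv p hp]

theorem mem_dir {T : Finset (Fin 4 × Fin 4)} {v : Space} :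
    v ∈ dir T ↔ ∀ p ∈ T, hom v p.1 = hom v p.2 := Iff.rfl

theorem dir_anti {S T : Finset (Fin 4 × Fin 4)} (h : S ⊆ T) : dir T ≤ dir S :=
  fun _ hv p hp => hv p (h hp)

variable {a : Matrix (Fin 4) (Fin 4) ℝ}

open Classical in
/-- The inequalities, indexed by pairs of distinct indices, that are tight at a point. -/
noncomputable def tight (a : Matrix (Fin 4) (Fin 4) ℝ) (x : Space) : Finset (Fin 4 × Fin 4) :=
  {p | p.1 ≠ p.2 ∧ hom x p.1 - hom x p.2 = a p.1 p.2}

theorem mem_tight {x : Space} {i j : Fin 4} :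
    (i, j) ∈ tight a x ↔ i ≠ j ∧ hom x i - hom x j = a i j := by
  simp [tight]

/-- The points of the polyhedron where all the inequalities in `T` are tight. -/
def tightFace (a : Matrix (Fin 4) (Fin 4) ℝ) (T : Finset (Fin 4 × Fin 4)) : Set Space :=
  {x ∈ body a | ∀ p ∈ T, hom x p.1 - hom x p.2 = a p.1 p.2}

theorem self_mem_tightFace {x : Space} (hx : x ∈ body a) : x ∈ tightFace a (tight a x) :=
  ⟨hx, fun _ hp => (mem_tight.1 hp).2⟩

theorem mem_tightFace_tight_iff {x y : Space} :
    y ∈ tightFace a (tight a x) ↔ y ∈ body a ∧ tight a x ⊆ tight a y :=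
  ⟨fun h => ⟨h.1, fun p hp => mem_tight.2 ⟨(mem_tight.1 hp).1, h.2 p hp⟩⟩,
    fun h => ⟨h.1, fun _ hp => (mem_tight.1 (h.2 hp)).2⟩⟩

theorem tight_eq_of_tightFace_eq {x y : Space} (hx : x ∈ body a) (hy : y ∈ body a)
    (h : tightFace a (tight a x) = tightFace a (tight a y)) : tight a x = tight a y :=
  (mem_tightFace_tight_iff.1 (h ▸ self_mem_tightFace hy)).2.antisymm
    (mem_tightFace_tight_iff.1 (h ▸ self_mem_tightFace hx)).2

/-- Slack inequalities remain slack under small displacements. -/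
theorem eventually_slack {x : Space} (hx : x ∈ body a) (v : Space) :
    ∀ᶠ t in nhds (0 : ℝ), ∀ i j, i ≠ j → (i, j) ∉ tight a x →
      a i j < hom (x + t • v) i - hom (x + t • v) j := by
  simp only [Filter.eventually_all]
  intro i j hij hp
  have hlt : a i j < hom x i - hom x j :=
    lt_of_le_of_ne (hx i j) fun h => hp (mem_tight.2 ⟨hij, h.symm⟩)
  have hc : Continuous fun t : ℝ => hom (x + t • v) i - hom (x + t • v) j :=
    ((continuous_hom i).comp (by fun_prop : Continuous fun t : ℝ => x + t • v)).sub
      ((continuous_hom j).comp (by fun_prop))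
  exact hc.continuousAt.eventually (p := fun z => a i j < z) (by
    simpa using lt_mem_nhds hlt)

theorem add_smul_mem_body {x v : Space} {t : ℝ} (hx : x ∈ body a) (ht : 0 ≤ t)
    (hs : ∀ i j, i ≠ j → (i, j) ∉ tight a x → a i j < hom (x + t • v) i - hom (x + t • v) j)
    (hv : ∀ p ∈ tight a x, 0 ≤ hom v p.1 - hom v p.2) : x + t • v ∈ body a := by
  intro i j
  rcases eq_or_ne i j with rfl | hij
  · simpa using hx i i
  by_cases hp : (i, j) ∈ tight a x
  · have := mul_nonneg ht (hv _ hp)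
    have := hx i j
    simp only [hom_add, hom_smul] at *
    linarith
  · exact (hs i j hij hp).le

theorem exists_pos_add_smul_mem {x v : Space} (hx : x ∈ body a) (hv : v ∈ dir (tight a x)) :
    ∃ t : ℝ, 0 < t ∧ x + t • v ∈ body a := by
  obtain ⟨t, hs, ht⟩ := ((eventually_slack hx v).filter_mono nhdsWithin_le_nhds
    |>.and (self_mem_nhdsWithin (s := Set.Ioi (0 : ℝ)))).exists
  exact ⟨t, ht, add_smul_mem_body hx (le_of_lt ht) hs fun p hp => by rw [hv p hp, sub_self]⟩

theorem add_smul_mem_tightFace_iff {x v : Space} {t : ℝ}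
    (hv : v ∈ dir (tight a x)) :
    x + t • v ∈ tightFace a (tight a x) ↔ x + t • v ∈ body a :=
  ⟨fun h => h.1, fun h => ⟨h, fun p hp => by
    rw [hom_add, hom_add, hom_smul, hom_smul, hv p hp, add_sub_add_right_eq_sub]
    exact (mem_tight.1 hp).2⟩⟩

theorem vectorSpan_tightFace {x : Space} (hx : x ∈ body a) :
    vectorSpan ℝ (tightFace a (tight a x)) = dir (tight a x) := by
  apply le_antisymm
  · refine Submodule.span_le.2 ?_
    rintro _ ⟨y, hy, z, hz, rfl⟩ p hp
    have h1 := hy.2 p hp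
    have h2 := hz.2 p hp
    simp only [vsub_eq_sub, hom_sub]
    linarith
  · intro v hv
    obtain ⟨t, ht, hm⟩ := exists_pos_add_smul_mem hx hv
    have := vsub_mem_vectorSpan ℝ ((add_smul_mem_tightFace_iff hv).2 hm) (self_mem_tightFace hx)
    rw [vsub_eq_sub, add_sub_cancel_left] at this
    simpa [smul_smul, inv_mul_cancel₀ ht.ne'] using Submodule.smul_mem _ t⁻¹ this

theorem isExposed_tightFace (T : Finset (Fin 4 × Fin 4)) :
    IsExposed ℝ (body a) (tightFace a T) := by
  rintro ⟨z, hz⟩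
  let l : Space →ₗ[ℝ] ℝ := - ∑ p ∈ T, (homLin p.1 - homLin p.2)
  have hl : ∀ x, l x = - ∑ p ∈ T, (hom x p.1 - hom x p.2) := by
    intro x; simp [l, LinearMap.sum_apply]
  refine ⟨LinearMap.toContinuousLinearMap l, ?_⟩
  have hle : ∀ y ∈ body a, l y ≤ - ∑ p ∈ T, a p.1 p.2 := fun y hy => by
    rw [hl]; exact neg_le_neg (Finset.sum_le_sum fun p _ => hy p.1 p.2)
  ext x
  simp only [LinearMap.coe_toContinuousLinearMap']
  refine ⟨fun hx => ⟨hx.1, fun y hy => (hle y hy).trans_eq ?_⟩, fun hx => ⟨hx.1, ?_⟩⟩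
  · rw [hl, Finset.sum_congr rfl hx.2]
  · have h1 := hx.2 z hz.1
    rw [hl, hl, Finset.sum_congr rfl hz.2, neg_le_neg_iff] at h1
    have h2 := (Finset.sum_eq_sum_iff_of_le fun p _ => hx.1 p.1 p.2).1
      (le_antisymm (Finset.sum_le_sum fun p _ => hx.1 p.1 p.2) h1)
    exact fun p hp => (h2 p hp).symm

/-- A nonempty exposed face is defined by the inequalities tight at any point of its relative
interior. Such a point is one with the least number of tight inequalities. -/
theorem exists_eq_tightFace {F : Set Space} (hne : F.Nonempty) (hF : IsExposed ℝ (body a) F) :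
    ∃ x ∈ body a, F = tightFace a (tight a x) := by
  obtain ⟨l, rfl⟩ := hF hne
  have hex : ∃ n, ∃ x ∈ {x ∈ body a | ∀ y ∈ body a, l y ≤ l x}, (tight a x).card = n :=
    ⟨_, hne.some, hne.some_mem, rfl⟩
  classical
  obtain ⟨x, hx, hxn⟩ := Nat.find_spec hex
  have hmin : ∀ y ∈ {x ∈ body a | ∀ y ∈ body a, l y ≤ l x}, (tight a x).card ≤ (tight a y).card :=
    fun y hy => hxn ▸ Nat.find_min' hex ⟨y, hy, rfl⟩
  refine ⟨x, hx.1, Set.Subset.antisymm (fun y hy => ?_) fun y hy => ⟨hy.1, ?_⟩⟩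
  · rw [mem_tightFace_tight_iff]
    refine ⟨hy.1, ?_⟩
    -- at the midpoint of `x` and `y` only the inequalities tight at both are tight
    set z := (1 / 2 : ℝ) • x + (1 / 2 : ℝ) • y with hzdef
    have hzi : ∀ i, hom z i = 1 / 2 * hom x i + 1 / 2 * hom y i := fun i => by
      rw [hzdef, hom_add, hom_smul, hom_smul]
    have hz : z ∈ {x ∈ body a | ∀ y ∈ body a, l y ≤ l x} := by
      refine ⟨fun i j => ?_, fun w hw => ?_⟩
      · have h1 := hx.1 i j
        have h2 := hy.1 i j
        rw [hzi, hzi]; linarith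
      · have h1 := hx.2 w hw
        have h2 := hy.2 w hw
        rw [hzdef, map_add, map_smul, map_smul, smul_eq_mul, smul_eq_mul]; linarith
    have hsub : tight a z ⊆ tight a x ∩ tight a y := by
      rintro ⟨i, j⟩ hp
      obtain ⟨hij, hp⟩ := mem_tight.1 hp
      rw [hzi, hzi] at hp
      have h1 := hx.1 i j
      have h2 := hy.1 i j
      exact Finset.mem_inter.2 ⟨mem_tight.2 ⟨hij, by linarith⟩, mem_tight.2 ⟨hij, by linarith⟩⟩
    have h := Finset.eq_of_subset_of_card_le (hsub.trans Finset.inter_subset_left) (hmin z hz)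
    exact h ▸ hsub.trans Finset.inter_subset_right
  · have hv : x - y ∈ dir (tight a x) := fun p hp => by
      have h1 := hy.2 p hp
      have h2 := (mem_tight.1 hp).2
      rw [hom_sub, hom_sub]; linarith
    obtain ⟨t, ht, hm⟩ := exists_pos_add_smul_mem hx.1 hv
    have h := hx.2 _ hm
    rw [map_add, map_smul, map_sub, smul_eq_mul] at h
    have : l x ≤ l y := by nlinarith
    exact fun w hw => (hx.2 w hw).trans this

theorem mem_faces {P : NonemptyCompacts Space} (hP : (P : Set Space) = body a) {k : ℕ}
    {F : Set Space} :
    F ∈ faces k P ↔ ∃ x ∈ body a, F = tightFace a (tight a x) ∧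
      Module.finrank ℝ (dir (tight a x)) = k := by
  constructor
  · rintro ⟨hne, hF, hk⟩
    rw [hP] at hF
    obtain ⟨x, hx, rfl⟩ := exists_eq_tightFace hne hF
    exact ⟨x, hx, rfl, by rwa [vectorSpan_tightFace hx] at hk⟩
  · rintro ⟨x, hx, rfl, hk⟩
    exact ⟨⟨x, self_mem_tightFace hx⟩, hP ▸ isExposed_tightFace _, by
      rwa [vectorSpan_tightFace hx]⟩

/-- A face is already determined by those of its tight inequalities that cut out the right
dimension. -/
theorem tightFace_eq_of_subset {x : Space} {T : Finset (Fin 4 × Fin 4)}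
    (hT : T ⊆ tight a x) (hk : Module.finrank ℝ (dir T) ≤ Module.finrank ℝ (dir (tight a x))) :
    tightFace a (tight a x) = tightFace a T := by
  have hdir := Submodule.eq_of_le_of_finrank_le (dir_anti hT) hk
  refine Set.Subset.antisymm (fun y hy => ⟨hy.1, fun p hp => hy.2 p (hT hp)⟩)
    fun y hy => ⟨hy.1, ?_⟩
  have hv : y - x ∈ dir T := fun p hp => by
    have h1 := hy.2 p hp
    have h2 := (mem_tight.1 (hT hp)).2
    rw [hom_sub, hom_sub]; linarith
  rw [← hdir] at hv
  intro p hp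
  have h1 := hv p hp
  have h2 := (mem_tight.1 hp).2
  rw [hom_sub, hom_sub] at h1
  linarith

/-! ### Spanning trees and forests on four nodes -/

/-- A system of three inequalities that are jointly tight at one point only. As graphs on the set of
indices, these are the spanning trees. -/
structure IsTree (T : Finset (Fin 4 × Fin 4)) : Prop where
  card : T.card = 3
  dir_eq_bot : dir T = ⊥

/-- The differences of coordinates along a forest. -/
def diffMap (T : Finset (Fin 4 × Fin 4)) : Space →ₗ[ℝ] (T → ℝ) :=
  LinearMap.pi fun p => homLin p.1.1 - homLin p.1.2

theorem diffMap_apply {T : Finset (Fin 4 × Fin 4)} (v : Space) (p : T) :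
    diffMap T v p = hom v p.1.1 - hom v p.1.2 := rfl

theorem ker_diffMap (T : Finset (Fin 4 × Fin 4)) : LinearMap.ker (diffMap T) = dir T := by
  ext v
  rw [LinearMap.mem_ker, mem_dir, funext_iff, Subtype.forall]
  simp only [diffMap_apply, Pi.zero_apply, sub_eq_zero]

/-- Differences along a tree can be prescribed. -/
theorem IsTree.diffMap_surjective {T : Finset (Fin 4 × Fin 4)} (hT : IsTree T) :
    Function.Surjective (diffMap T) := by
  have hinj : Function.Injective (diffMap T) := by
    rw [← LinearMap.ker_eq_bot, ker_diffMap, hT.dir_eq_bot]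
  refine (LinearMap.injective_iff_surjective_of_finrank_eq_finrank ?_).1 hinj
  simp [hT.card]

theorem IsTree.exists_diff_eq {T : Finset (Fin 4 × Fin 4)} (hT : IsTree T)
    (f : Fin 4 × Fin 4 → ℝ) : ∃ v : Space, ∀ p ∈ T, hom v p.1 - hom v p.2 = f p := by
  obtain ⟨v, hv⟩ := hT.diffMap_surjective fun p => f p
  exact ⟨v, fun p hp => congr_fun hv ⟨p, hp⟩⟩

theorem IsTree.finrank_dir {S T : Finset (Fin 4 × Fin 4)} (hT : IsTree T) (hS : S ⊆ T) :
    Module.finrank ℝ (dir S) = 3 - S.card := by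
  have hsurj : Function.Surjective (diffMap S) := by
    intro f
    obtain ⟨v, hv⟩ := hT.exists_diff_eq fun p => if h : p ∈ S then f ⟨p, h⟩ else 0
    refine ⟨v, funext fun p => ?_⟩
    rw [diffMap_apply, hv _ (hS p.2)]
    simp
  have h := (diffMap S).finrank_range_add_finrank_ker
  rw [LinearMap.range_eq_top.2 hsurj, finrank_top, ker_diffMap] at h
  simp at h
  omega

theorem dir_eq_bot_of_forall {T : Finset (Fin 4 × Fin 4)}
    (h : ∀ v ∈ dir T, ∀ i, hom v i = hom v 3) : dir T = ⊥ := by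
  rw [eq_bot_iff]
  intro v hv
  rw [Submodule.mem_bot]
  funext i
  have := h v hv i.castSucc
  simpa using this

/-- The tree of all arcs leaving `i`. -/
def star (i : Fin 4) : Finset (Fin 4 × Fin 4) := {p | p.1 = i ∧ p.2 ≠ i}

/-- The tree of all arcs entering `j`. -/
def costar (j : Fin 4) : Finset (Fin 4 × Fin 4) := {p | p.2 = j ∧ p.1 ≠ j}

/-- The path `k ← i → j ← l`. -/
def path (i j k l : Fin 4) : Finset (Fin 4 × Fin 4) := {(i, j), (i, k), (l, j)}

theorem eq_or_of_distinct : ∀ i j k l : Fin 4, i ≠ j → i ≠ k → i ≠ l → j ≠ k → j ≠ l → k ≠ l →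
    ∀ m, m = i ∨ m = j ∨ m = k ∨ m = l := by
  intros; omega

theorem isTree_star (i : Fin 4) : IsTree (star i) where
  card := by decide +revert
  dir_eq_bot := by
    have h : ∀ v ∈ dir (star i), ∀ j, hom v i = hom v j := fun v hv j => by
      rcases eq_or_ne j i with rfl | hj
      · rfl
      · exact hv (i, j) (by simp [star, hj])
    exact dir_eq_bot_of_forall fun v hv j => (h v hv j).symm.trans (h v hv 3)

theorem isTree_costar (i : Fin 4) : IsTree (costar i) where
  card := by decide +revert
  dir_eq_bot := by
    have h : ∀ v ∈ dir (costar i), ∀ j, hom v j = hom v i := fun v hv j => by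
      rcases eq_or_ne j i with rfl | hj
      · rfl
      · exact hv (j, i) (by simp [costar, hj])
    exact dir_eq_bot_of_forall fun v hv j => (h v hv j).trans (h v hv 3).symm

theorem isTree_path {i j k l : Fin 4} (hij : i ≠ j) (hik : i ≠ k) (hil : i ≠ l) (hjk : j ≠ k)
    (hjl : j ≠ l) (hkl : k ≠ l) : IsTree (path i j k l) where
  card := by
    rw [path, Finset.card_eq_three]
    exact ⟨_, _, _, by simp [hjk], by simp [hil], by simp [hil], rfl⟩
  dir_eq_bot := by
    have h : ∀ v ∈ dir (path i j k l), ∀ m, hom v m = hom v i := fun v hv m => by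
      have h1 := hv (i, j) (by simp [path])
      have h2 := hv (i, k) (by simp [path])
      have h3 := hv (l, j) (by simp [path])
      simp only at h1 h2 h3
      rcases eq_or_of_distinct i j k l hij hik hil hjk hjl hkl m with rfl | rfl | rfl | rfl <;>
        linarith
    exact dir_eq_bot_of_forall fun v hv j => (h v hv j).trans (h v hv 3).symm

/-! ### Labels for vertices, edges and facets

A tropical minor of order two without diagonal entries is given by its two rows `row₁ m`, `row₂ m`
and its two columns `col₁ m`, `col₂ m`. The order of the minors is that of the difference tuple. -/

/-- First row of a minor. -/
def row₁ : Fin 6 → Fin 4 := ![0, 0, 0, 2, 1, 1]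
/-- Second row of a minor. -/
def row₂ : Fin 6 → Fin 4 := ![1, 3, 2, 3, 2, 3]
/-- First column of a minor. -/
def col₁ : Fin 6 → Fin 4 := ![3, 2, 1, 1, 3, 0]
/-- Second column of a minor. -/
def col₂ : Fin 6 → Fin 4 := ![2, 1, 3, 0, 0, 2]

/-- The paths from the rows to the columns of a minor. The arcs fall into two perfect matchings;
the matching with the missing arc is selected by `β`, and the arc by `b`. -/
def pathOf (m : Fin 6) (β b : Bool) : Finset (Fin 4 × Fin 4) :=
  match β, b with
  | true, true => path (row₁ m) (col₁ m) (col₂ m) (row₂ m)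
  | true, false => path (row₂ m) (col₂ m) (col₁ m) (row₁ m)
  | false, true => path (row₁ m) (col₂ m) (col₁ m) (row₂ m)
  | false, false => path (row₂ m) (col₁ m) (col₂ m) (row₁ m)

/-- The perfect matchings between the rows and the columns of a minor; `β` selects the
complementary matching. -/
def matching (m : Fin 6) (β : Bool) : Finset (Fin 4 × Fin 4) :=
  match β with
  | true => {(row₁ m, col₂ m), (row₂ m, col₁ m)}
  | false => {(row₁ m, col₁ m), (row₂ m, col₂ m)}

/-- Ordered pairs of distinct indices. -/
abbrev Arc := {p : Fin 4 × Fin 4 // p.1 ≠ p.2}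

/-- Labels for the vertices of an alcoved polyhedron: two families of stars, and paths. -/
abbrev VertexLabel := Fin 4 ⊕ Fin 4 ⊕ Fin 6 × Bool

/-- Labels for the edges: stars with a missing arc, and perfect matchings. -/
abbrev EdgeLabel := Arc ⊕ Arc ⊕ Fin 6

/-- The tree of inequalities tight at a labelled vertex. The Booleans `β` are the signs of the
minors. -/
def vertexTree (β : Fin 6 → Bool) : VertexLabel → Finset (Fin 4 × Fin 4)
  | .inl i => star i
  | .inr (.inl j) => costar j
  | .inr (.inr (m, b)) => pathOf m (β m) b

/-- The forest of inequalities tight along a labelled edge. -/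
def edgeForest (β : Fin 6 → Bool) : EdgeLabel → Finset (Fin 4 × Fin 4)
  | .inl p => (star p.1.1).erase p.1
  | .inr (.inl p) => (costar p.1.2).erase p.1
  | .inr (.inr m) => matching m (β m)

theorem rows_columns_distinct (m : Fin 6) :
    row₁ m ≠ col₁ m ∧ row₁ m ≠ col₂ m ∧ row₁ m ≠ row₂ m ∧ col₁ m ≠ col₂ m ∧
      col₁ m ≠ row₂ m ∧ col₂ m ≠ row₂ m := by
  decide +revert

theorem isTree_pathOf (m : Fin 6) (β b : Bool) : IsTree (pathOf m β b) := by
  obtain ⟨h1, h2, h3, h4, h5, h6⟩ := rows_columns_distinct m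
  cases β <;> cases b <;> apply isTree_path <;> first | assumption | (apply Ne.symm; assumption)

theorem isTree_vertexTree (β : Fin 6 → Bool) (c : VertexLabel) : IsTree (vertexTree β c) := by
  rcases c with i | j | ⟨m, b⟩
  exacts [isTree_star i, isTree_costar j, isTree_pathOf m _ b]

theorem matching_subset_pathOf (m : Fin 6) (β : Bool) : matching m β ⊆ pathOf m β true := by
  cases β <;> simp [matching, pathOf, path]

theorem exists_edgeForest_subset (β : Fin 6 → Bool) (c : EdgeLabel) :
    ∃ d, edgeForest β c ⊆ vertexTree β d := by
  rcases c with p | p | m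
  exacts [⟨.inl p.1.1, Finset.erase_subset _ _⟩, ⟨.inr (.inl p.1.2), Finset.erase_subset _ _⟩,
    ⟨.inr (.inr (m, true)), matching_subset_pathOf m _⟩]

theorem card_matching (m : Fin 6) (β : Bool) : (matching m β).card = 2 := by
  decide +revert

theorem card_edgeForest (β : Fin 6 → Bool) (c : EdgeLabel) : (edgeForest β c).card = 2 := by
  rcases c with p | p | m
  · have : p.1 ∈ star p.1.1 := by simp [star, p.2.symm]
    simp [edgeForest, Finset.card_erase_of_mem this, (isTree_star _).card]
  · have : p.1 ∈ costar p.1.2 := by simp [costar, p.2]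
    simp [edgeForest, Finset.card_erase_of_mem this, (isTree_costar _).card]
  · exact card_matching m _

theorem arc_subset_star (p : Arc) : {p.1} ⊆ star p.1.1 := by
  simp [star, p.2.symm]

theorem finrank_dir_vertexTree (β : Fin 6 → Bool) (c : VertexLabel) :
    Module.finrank ℝ (dir (vertexTree β c)) = 0 := by
  simp [(isTree_vertexTree β c).dir_eq_bot]

theorem finrank_dir_edgeForest (β : Fin 6 → Bool) (c : EdgeLabel) :
    Module.finrank ℝ (dir (edgeForest β c)) = 1 := by
  obtain ⟨d, hd⟩ := exists_edgeForest_subset β c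
  rw [(isTree_vertexTree β d).finrank_dir hd, card_edgeForest]

theorem finrank_dir_arc (p : Arc) : Module.finrank ℝ (dir {p.1}) = 2 := by
  rw [(isTree_star _).finrank_dir (arc_subset_star p)]; simp

theorem star_injective : Function.Injective star := by decide
theorem costar_injective : Function.Injective costar := by decide
theorem star_ne_costar : ∀ i j, star i ≠ costar j := by decide
theorem star_ne_pathOf : ∀ i m β b, star i ≠ pathOf m β b := by decide +kernel
theorem costar_ne_pathOf : ∀ i m β b, costar i ≠ pathOf m β b := by decide +kernel
theorem pathOf_eq_imp : ∀ m m' β β' b b', pathOf m β b = pathOf m' β' b' →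
    m = m' ∧ (β = β' → b = b') := by decide +kernel

theorem vertexTree_injective (β : Fin 6 → Bool) : Function.Injective (vertexTree β) := by
  rintro (i | i | ⟨m, b⟩) (j | j | ⟨n, c⟩) h
  · exact congr_arg _ (star_injective h)
  · exact (star_ne_costar _ _ h).elim
  · exact (star_ne_pathOf _ _ _ _ h).elim
  · exact (star_ne_costar _ _ h.symm).elim
  · exact congr_arg _ (congr_arg _ (costar_injective h))
  · exact (costar_ne_pathOf _ _ _ _ h).elim
  · exact (star_ne_pathOf _ _ _ _ h.symm).elim
  · exact (costar_ne_pathOf _ _ _ _ h.symm).elim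
  · obtain ⟨rfl, h2⟩ := pathOf_eq_imp _ _ _ _ _ _ h
    rw [h2 rfl]

theorem star_erase_injective : Function.Injective fun p : Arc => (star p.1.1).erase p.1 := by
  decide +kernel
theorem costar_erase_injective : Function.Injective fun p : Arc => (costar p.1.2).erase p.1 := by
  decide +kernel
theorem star_erase_ne_costar_erase : ∀ p q : Arc,
    (star p.1.1).erase p.1 ≠ (costar q.1.2).erase q.1 := by decide +kernel
theorem star_erase_ne_matching : ∀ (p : Arc) (m : Fin 6) (β : Bool),
    (star p.1.1).erase p.1 ≠ matching m β := by decide +kernel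
theorem costar_erase_ne_matching : ∀ (p : Arc) (m : Fin 6) (β : Bool),
    (costar p.1.2).erase p.1 ≠ matching m β := by decide +kernel
theorem matching_eq_imp : ∀ m m' β β', matching m β = matching m' β' → m = m' := by
  decide +kernel

theorem edgeForest_injective (β : Fin 6 → Bool) : Function.Injective (edgeForest β) := by
  rintro (p | p | m) (q | q | n) h
  · exact congr_arg _ (star_erase_injective h)
  · exact (star_erase_ne_costar_erase _ _ h).elim
  · exact (star_erase_ne_matching _ _ _ h).elim
  · exact (star_erase_ne_costar_erase _ _ h.symm).elim
  · exact congr_arg _ (congr_arg _ (costar_erase_injective h))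
  · exact (costar_erase_ne_matching _ _ _ h).elim
  · exact (star_erase_ne_matching _ _ _ h.symm).elim
  · exact (costar_erase_ne_matching _ _ _ h.symm).elim
  · rw [matching_eq_imp _ _ _ _ h]

theorem card_vertexLabel : Fintype.card VertexLabel = 20 := by decide
theorem card_arc : Fintype.card Arc = 12 := by decide
theorem card_edgeLabel : Fintype.card EdgeLabel = 30 := by
  simp only [Fintype.card_sum, card_arc, Fintype.card_fin]

/-! ### Upper bounds for the numbers of faces -/

/-- Whether the matching `(row₁, col₁), (row₂, col₂)` of a minor is the smaller one; it counts as
the smaller one if the minor vanishes. -/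
noncomputable def orient (a : Matrix (Fin 4) (Fin 4) ℝ) (m : Fin 6) : Bool :=
  open Classical in
  decide (a (row₁ m) (col₁ m) + a (row₂ m) (col₂ m) ≤ a (row₁ m) (col₂ m) + a (row₂ m) (col₁ m))

theorem orient_eq_true_iff {m : Fin 6} : orient a m = true ↔
    a (row₁ m) (col₁ m) + a (row₂ m) (col₂ m) ≤ a (row₁ m) (col₂ m) + a (row₂ m) (col₁ m) := by
  simp [orient]

theorem orient_eq_false_iff {m : Fin 6} : orient a m = false ↔
    a (row₁ m) (col₂ m) + a (row₂ m) (col₁ m) < a (row₁ m) (col₁ m) + a (row₂ m) (col₂ m) := by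
  simp [orient]

/-- The tight inequalities at a point of an alcoved polyhedron form a strict partial order. -/
theorem tight_trans (ha : IsKleene a) (h2 : ∀ i j, i ≠ j → a i j + a j i < 0) {x : Space}
    (hx : x ∈ body a) {i j k : Fin 4} (hij : (i, j) ∈ tight a x) (hjk : (j, k) ∈ tight a x) :
    (i, k) ∈ tight a x := by
  obtain ⟨nij, hij⟩ := mem_tight.1 hij
  obtain ⟨njk, hjk⟩ := mem_tight.1 hjk
  have hik := hx i k
  have := ha.idem i k j
  refine mem_tight.2 ⟨?_, by linarith⟩
  rintro rfl
  have := h2 i j nij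
  linarith

/-- A tight matching is the larger one of its minor, or else the minor vanishes and the other
matching is tight as well. -/
theorem tight_square {x : Space} (hx : x ∈ body a) {i j k l : Fin 4} (hik : i ≠ k) (hlj : l ≠ j)
    (hij : (i, j) ∈ tight a x) (hlk : (l, k) ∈ tight a x)
    (hle : a i j + a l k ≤ a i k + a l j) : (i, k) ∈ tight a x ∧ (l, j) ∈ tight a x := by
  obtain ⟨-, hij⟩ := mem_tight.1 hij
  obtain ⟨-, hlk⟩ := mem_tight.1 hlk
  have h1 := hx i k
  have h2 := hx l j
  exact ⟨mem_tight.2 ⟨hik, by linarith⟩, mem_tight.2 ⟨hlj, by linarith⟩⟩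

theorem exists_minor_of_distinct : ∀ i j k l : Fin 4,
    i ≠ j → i ≠ k → i ≠ l → j ≠ k → j ≠ l → k ≠ l →
    ∃ m, (row₁ m = i ∧ row₂ m = l ∧ col₁ m = j ∧ col₂ m = k) ∨
      (row₁ m = l ∧ row₂ m = i ∧ col₁ m = k ∧ col₂ m = j) ∨
      (row₁ m = i ∧ row₂ m = l ∧ col₁ m = k ∧ col₂ m = j) ∨
      (row₁ m = l ∧ row₂ m = i ∧ col₁ m = j ∧ col₂ m = k) := by
  decide +kernel

/-- A tight path contains, up to replacement in the case of a vanishing minor, a labelled one. -/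
theorem exists_pathOf_subset {x : Space} (hx : x ∈ body a) {i j k l : Fin 4} (nij : i ≠ j)
    (nik : i ≠ k) (nil : i ≠ l) (njk : j ≠ k) (njl : j ≠ l) (nkl : k ≠ l)
    (hij : (i, j) ∈ tight a x) (hik : (i, k) ∈ tight a x) (hlj : (l, j) ∈ tight a x) :
    ∃ m b, pathOf m (orient a m) b ⊆ tight a x := by
  have key : a i j + a l k ≤ a i k + a l j := by
    have h1 := (mem_tight.1 hij).2
    have h2 := (mem_tight.1 hik).2
    have h3 := (mem_tight.1 hlj).2
    have h4 := hx l k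
    linarith
  have tie : a i k + a l j ≤ a i j + a l k → (l, k) ∈ tight a x := fun h =>
    (tight_square hx nij nkl.symm hik hlj h).2
  obtain ⟨m, hm⟩ := exists_minor_of_distinct i j k l nij nik nil njk njl nkl
  refine ⟨m, ?_⟩
  rcases ho : orient a m with _ | _
  · rw [orient_eq_false_iff] at ho
    rcases hm with ⟨h1, h2, h3, h4⟩ | ⟨h1, h2, h3, h4⟩ | ⟨h1, h2, h3, h4⟩ | ⟨h1, h2, h3, h4⟩ <;>
      rw [h1, h2, h3, h4] at ho
    · linarith
    · linarith
    · refine ⟨true, ?_⟩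
      simp [pathOf, path, Finset.insert_subset_iff, *]
    · refine ⟨false, ?_⟩
      simp [pathOf, path, Finset.insert_subset_iff, *]
  · rw [orient_eq_true_iff] at ho
    rcases hm with ⟨h1, h2, h3, h4⟩ | ⟨h1, h2, h3, h4⟩ | ⟨h1, h2, h3, h4⟩ | ⟨h1, h2, h3, h4⟩ <;>
      rw [h1, h2, h3, h4] at ho
    · refine ⟨true, ?_⟩
      simp [pathOf, path, Finset.insert_subset_iff, *]
    · refine ⟨false, ?_⟩
      simp [pathOf, path, Finset.insert_subset_iff, *]
    · have := tie ho
      refine ⟨true, ?_⟩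
      simp [pathOf, path, Finset.insert_subset_iff, *]
    · have := tie (by linarith)
      refine ⟨true, ?_⟩
      simp [pathOf, path, Finset.insert_subset_iff, *]

theorem exists_matching_subset {x : Space} (hx : x ∈ body a) {i j k l : Fin 4} (nij : i ≠ j)
    (nik : i ≠ k) (nil : i ≠ l) (njk : j ≠ k) (njl : j ≠ l) (nkl : k ≠ l)
    (hij : (i, j) ∈ tight a x) (hlk : (l, k) ∈ tight a x) :
    ∃ m, matching m (orient a m) ⊆ tight a x := by
  have tie : a i j + a l k ≤ a i k + a l j → (i, k) ∈ tight a x ∧ (l, j) ∈ tight a x :=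
    tight_square hx nik njl.symm hij hlk
  obtain ⟨m, hm⟩ := exists_minor_of_distinct i j k l nij nik nil njk njl nkl
  refine ⟨m, ?_⟩
  rcases ho : orient a m with _ | _
  · rw [orient_eq_false_iff] at ho
    rcases hm with ⟨h1, h2, h3, h4⟩ | ⟨h1, h2, h3, h4⟩ | ⟨h1, h2, h3, h4⟩ | ⟨h1, h2, h3, h4⟩ <;>
      rw [h1, h2, h3, h4] at ho
    · simp [matching, Finset.insert_subset_iff, *]
    · simp [matching, Finset.insert_subset_iff, *]
    · simp [matching, h1, h2, h3, h4, Finset.insert_subset_iff, tie ho.le]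
    · simp [matching, h1, h2, h3, h4, Finset.insert_subset_iff, tie (by linarith)]
  · rw [orient_eq_true_iff] at ho
    rcases hm with ⟨h1, h2, h3, h4⟩ | ⟨h1, h2, h3, h4⟩ | ⟨h1, h2, h3, h4⟩ | ⟨h1, h2, h3, h4⟩ <;>
      rw [h1, h2, h3, h4] at ho
    · simp [matching, h1, h2, h3, h4, Finset.insert_subset_iff, tie ho]
    · simp [matching, h1, h2, h3, h4, Finset.insert_subset_iff, tie (by linarith)]
    · simp [matching, Finset.insert_subset_iff, *]
    · simp [matching, Finset.insert_subset_iff, *]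

theorem star_subset_of {G : Finset (Fin 4 × Fin 4)} {i j k l : Fin 4} (nij : i ≠ j)
    (nik : i ≠ k) (nil : i ≠ l) (njk : j ≠ k) (njl : j ≠ l) (nkl : k ≠ l)
    (hij : (i, j) ∈ G) (hik : (i, k) ∈ G) (hil : (i, l) ∈ G) : star i ⊆ G := by
  rintro ⟨c, d⟩ h
  obtain ⟨h1, h2⟩ : c = i ∧ d ≠ i := by simpa [star] using h
  subst h1
  rcases eq_or_of_distinct c j k l nij nik nil njk njl nkl d with rfl | rfl | rfl | rfl
  exacts [(h2 rfl).elim, hij, hik, hil]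

theorem costar_subset_of {G : Finset (Fin 4 × Fin 4)} {i j k l : Fin 4} (nij : i ≠ j)
    (nik : i ≠ k) (nil : i ≠ l) (njk : j ≠ k) (njl : j ≠ l) (nkl : k ≠ l)
    (hij : (j, i) ∈ G) (hik : (k, i) ∈ G) (hil : (l, i) ∈ G) : costar i ⊆ G := by
  rintro ⟨c, d⟩ h
  obtain ⟨h1, h2⟩ : d = i ∧ c ≠ i := by simpa [costar] using h
  subst h1
  rcases eq_or_of_distinct d j k l nij nik nil njk njl nkl c with rfl | rfl | rfl | rfl
  exacts [(h2 rfl).elim, hij, hik, hil]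

theorem star_erase_subset_of {G : Finset (Fin 4 × Fin 4)} {i j k l : Fin 4} (nij : i ≠ j)
    (nik : i ≠ k) (nil : i ≠ l) (njk : j ≠ k) (njl : j ≠ l) (nkl : k ≠ l)
    (hij : (i, j) ∈ G) (hik : (i, k) ∈ G) : (star i).erase (i, l) ⊆ G := by
  rw [← Finset.subset_insert_iff]
  exact star_subset_of nij nik nil njk njl nkl (by simp [hij]) (by simp [hik]) (by simp)

theorem costar_erase_subset_of {G : Finset (Fin 4 × Fin 4)} {i j k l : Fin 4} (nij : i ≠ j)
    (nik : i ≠ k) (nil : i ≠ l) (njk : j ≠ k) (njl : j ≠ l) (nkl : k ≠ l)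
    (hij : (j, i) ∈ G) (hik : (k, i) ∈ G) : (costar i).erase (l, i) ⊆ G := by
  rw [← Finset.subset_insert_iff]
  exact costar_subset_of nij nik nil njk njl nkl (by simp [hij]) (by simp [hik]) (by simp)

theorem exists_fourth : ∀ i j k : Fin 4, i ≠ j → i ≠ k → j ≠ k → ∃ l, i ≠ l ∧ j ≠ l ∧ k ≠ l := by
  decide

/-- If `T` does not cut out a subspace as small as `G` does, then `G` has an arc that joins
different components of `T`. -/
theorem exists_mem_ne {T G : Finset (Fin 4 × Fin 4)}
    (h : Module.finrank ℝ (dir G) < Module.finrank ℝ (dir T)) :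
    ∃ p ∈ G, ∃ v ∈ dir T, hom v p.1 ≠ hom v p.2 := by
  by_contra! hcon
  exact absurd (Submodule.finrank_mono (fun v hv p hp => hcon p hp v hv : dir T ≤ dir G))
    (not_le.2 h)

theorem exists_arc_subset {x : Space} (h : Module.finrank ℝ (dir (tight a x)) < 3) :
    ∃ p : Arc, {p.1} ⊆ tight a x := by
  have h0 : Module.finrank ℝ (dir ∅) = 3 := by
    rw [(isTree_star 0).finrank_dir (Finset.empty_subset _)]; rfl
  obtain ⟨p, hp, -⟩ := exists_mem_ne (T := ∅) (h.trans_eq h0.symm)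
  exact ⟨⟨p, (mem_tight.1 hp).1⟩, by simpa using hp⟩

theorem exists_edgeForest_subset_tight (ha : IsKleene a)
    (h2 : ∀ i j, i ≠ j → a i j + a j i < 0) {x : Space} (hx : x ∈ body a)
    (h : Module.finrank ℝ (dir (tight a x)) < 2) : ∃ c, edgeForest (orient a) c ⊆ tight a x := by
  obtain ⟨⟨⟨i, j⟩, nij⟩, hp⟩ := exists_arc_subset (h.trans (by norm_num))
  simp only [Finset.singleton_subset_iff] at hp nij
  obtain ⟨⟨c, d⟩, hq, v, hv, hvq⟩ :=
    exists_mem_ne (T := {(i, j)}) (h.trans_eq (finrank_dir_arc ⟨(i, j), nij⟩).symm)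
  have hvij : hom v i = hom v j := hv (i, j) (by simp)
  simp only at hvq
  have ncd := (mem_tight.1 hq).1
  have hstar : ∀ k, (i, k) ∈ tight a x → j ≠ k → ∃ c, edgeForest (orient a) c ⊆ tight a x := by
    intro k hk njk
    have nik := (mem_tight.1 hk).1
    obtain ⟨l, nil, njl, nkl⟩ := exists_fourth i j k nij nik njk
    exact ⟨.inl ⟨(i, l), nil⟩, star_erase_subset_of nij nik nil njk njl nkl hp hk⟩
  have hcostar : ∀ k, (k, j) ∈ tight a x → i ≠ k → ∃ c, edgeForest (orient a) c ⊆ tight a x := by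
    intro k hk nik
    have nkj := (mem_tight.1 hk).1
    obtain ⟨l, nil, njl, nkl⟩ := exists_fourth i j k nij nik nkj.symm
    exact ⟨.inr (.inl ⟨(l, j), njl.symm⟩),
      costar_erase_subset_of nij.symm nkj.symm njl nik nil nkl hp hk⟩
  by_cases hci : c = i
  · subst hci
    exact hstar d hq (by rintro rfl; exact hvq hvij)
  by_cases hdj : d = j
  · subst hdj
    exact hcostar c hq (Ne.symm hci)
  by_cases hcj : c = j
  · subst hcj
    exact hstar d (tight_trans ha h2 hx hp hq) ncd
  by_cases hdi : d = i
  · subst hdi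
    exact hcostar c (tight_trans ha h2 hx hq hp) (Ne.symm ncd)
  obtain ⟨m, hm⟩ := exists_matching_subset hx nij (Ne.symm hdi) (Ne.symm hci) (Ne.symm hdj)
    (Ne.symm hcj) ncd.symm hp hq
  exact ⟨.inr (.inr m), hm⟩

/-- Completing a star with a missing arc: a tight arc `c → d` at the remaining index `l` yields a
star, after composition with the arcs leaving `i`, or a path. -/
theorem exists_vertexTree_of_star (ha : IsKleene a)
    (h2 : ∀ i j, i ≠ j → a i j + a j i < 0) {x : Space} (hx : x ∈ body a) {i j k l c d : Fin 4}
    (nij : i ≠ j) (nik : i ≠ k) (nil : i ≠ l) (njk : j ≠ k) (njl : j ≠ l) (nkl : k ≠ l)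
    (hij : (i, j) ∈ tight a x) (hik : (i, k) ∈ tight a x) (hcd : (c, d) ∈ tight a x) {v : Space}
    (hvj : hom v i = hom v j) (hvk : hom v i = hom v k) (hv : hom v c ≠ hom v d) :
    ∃ c, vertexTree (orient a) c ⊆ tight a x := by
  have ofArc : (i, l) ∈ tight a x → ∃ c, vertexTree (orient a) c ⊆ tight a x := fun h =>
    ⟨.inl i, star_subset_of nij nik nil njk njl nkl hij hik h⟩
  have ofPath : ∀ m b, pathOf m (orient a m) b ⊆ tight a x →
      ∃ c, vertexTree (orient a) c ⊆ tight a x := fun m b h => ⟨.inr (.inr (m, b)), h⟩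
  rcases eq_or_of_distinct i j k l nij nik nil njk njl nkl c with rfl | rfl | rfl | rfl <;>
    rcases eq_or_of_distinct _ _ _ _ nij nik nil njk njl nkl d with rfl | rfl | rfl | rfl
  case inl.inr.inr.inr => exact ofArc hcd
  case inr.inl.inr.inr.inr => exact ofArc (tight_trans ha h2 hx hij hcd)
  case inr.inr.inl.inr.inr.inr => exact ofArc (tight_trans ha h2 hx hik hcd)
  case inr.inr.inr.inl =>
    exact ⟨.inl c, star_subset_of nil.symm njl.symm nkl.symm nij nik njk hcd
      (tight_trans ha h2 hx hcd hij) (tight_trans ha h2 hx hcd hik)⟩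
  case inr.inr.inr.inr.inl =>
    obtain ⟨m, b, h⟩ := exists_pathOf_subset hx nij nik nil njk njl nkl hij hik hcd
    exact ofPath m b h
  case inr.inr.inr.inr.inr.inl =>
    obtain ⟨m, b, h⟩ := exists_pathOf_subset hx nik nij nil njk.symm nkl njl hik hij hcd
    exact ofPath m b h
  all_goals exact (hv (by linarith)).elim

theorem exists_vertexTree_of_costar (ha : IsKleene a)
    (h2 : ∀ i j, i ≠ j → a i j + a j i < 0) {x : Space} (hx : x ∈ body a) {i j k l c d : Fin 4}
    (nij : i ≠ j) (nik : i ≠ k) (nil : i ≠ l) (njk : j ≠ k) (njl : j ≠ l) (nkl : k ≠ l)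
    (hij : (j, i) ∈ tight a x) (hik : (k, i) ∈ tight a x) (hcd : (c, d) ∈ tight a x) {v : Space}
    (hvj : hom v i = hom v j) (hvk : hom v i = hom v k) (hv : hom v c ≠ hom v d) :
    ∃ c, vertexTree (orient a) c ⊆ tight a x := by
  have ofArc : (l, i) ∈ tight a x → ∃ c, vertexTree (orient a) c ⊆ tight a x := fun h =>
    ⟨.inr (.inl i), costar_subset_of nij nik nil njk njl nkl hij hik h⟩
  have ofPath : ∀ m b, pathOf m (orient a m) b ⊆ tight a x →
      ∃ c, vertexTree (orient a) c ⊆ tight a x := fun m b h => ⟨.inr (.inr (m, b)), h⟩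
  rcases eq_or_of_distinct i j k l nij nik nil njk njl nkl c with rfl | rfl | rfl | rfl <;>
    rcases eq_or_of_distinct _ _ _ _ nij nik nil njk njl nkl d with rfl | rfl | rfl | rfl
  case inr.inr.inr.inl => exact ofArc hcd
  case inr.inr.inr.inr.inl => exact ofArc (tight_trans ha h2 hx hcd hij)
  case inr.inr.inr.inr.inr.inl => exact ofArc (tight_trans ha h2 hx hcd hik)
  case inl.inr.inr.inr =>
    exact ⟨.inr (.inl d), costar_subset_of nil.symm njl.symm nkl.symm nij nik njk hcd
      (tight_trans ha h2 hx hij hcd) (tight_trans ha h2 hx hik hcd)⟩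
  case inr.inl.inr.inr.inr =>
    obtain ⟨m, b, h⟩ := exists_pathOf_subset hx nij.symm njl njk nil nik nkl.symm hij hcd hik
    exact ofPath m b h
  case inr.inr.inl.inr.inr.inr =>
    obtain ⟨m, b, h⟩ := exists_pathOf_subset hx nik.symm nkl njk.symm nil nij njl.symm hik hcd hij
    exact ofPath m b h
  all_goals exact (hv (by linarith)).elim

theorem exists_vertexTree_of_matching (ha : IsKleene a)
    (h2 : ∀ i j, i ≠ j → a i j + a j i < 0) {x : Space} (hx : x ∈ body a) {i j k l c d : Fin 4}
    (nij : i ≠ j) (nik : i ≠ k) (nil : i ≠ l) (njk : j ≠ k) (njl : j ≠ l) (nkl : k ≠ l)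
    (hij : (i, j) ∈ tight a x) (hlk : (l, k) ∈ tight a x) (hcd : (c, d) ∈ tight a x) {v : Space}
    (hvj : hom v i = hom v j) (hvk : hom v l = hom v k) (hv : hom v c ≠ hom v d) :
    ∃ c, vertexTree (orient a) c ⊆ tight a x := by
  -- any arc between the two components composes with the given arcs to an arc from the source of
  -- one to the sink of the other, and the three arcs form a path
  have ofArc : ∀ {i j k l : Fin 4}, i ≠ j → i ≠ k → i ≠ l → j ≠ k → j ≠ l → k ≠ l →
      (i, j) ∈ tight a x → (l, k) ∈ tight a x → (i, k) ∈ tight a x →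
      ∃ c, vertexTree (orient a) c ⊆ tight a x := by
    intro i j k l nij nik nil njk njl nkl hij hlk h
    obtain ⟨m, b, h⟩ := exists_pathOf_subset hx nik nij nil njk.symm nkl njl h hij hlk
    exact ⟨.inr (.inr (m, b)), h⟩
  rcases eq_or_of_distinct i j k l nij nik nil njk njl nkl c with rfl | rfl | rfl | rfl <;>
    rcases eq_or_of_distinct _ _ _ _ nij nik nil njk njl nkl d with rfl | rfl | rfl | rfl
  case inl.inr.inr.inl => exact ofArc nij nik nil njk njl nkl hij hlk hcd
  case inl.inr.inr.inr =>
    exact ofArc nij nik nil njk njl nkl hij hlk (tight_trans ha h2 hx hcd hlk)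
  case inr.inl.inr.inr.inl =>
    exact ofArc nij nik nil njk njl nkl hij hlk (tight_trans ha h2 hx hij hcd)
  case inr.inl.inr.inr.inr =>
    exact ofArc nij nik nil njk njl nkl hij hlk
      (tight_trans ha h2 hx hij (tight_trans ha h2 hx hcd hlk))
  case inr.inr.inl.inl =>
    exact ofArc nkl.symm njl.symm nil.symm njk.symm nik.symm nij.symm hlk hij
      (tight_trans ha h2 hx hlk (tight_trans ha h2 hx hcd hij))
  case inr.inr.inl.inr.inl =>
    exact ofArc nkl.symm njl.symm nil.symm njk.symm nik.symm nij.symm hlk hij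
      (tight_trans ha h2 hx hlk hcd)
  case inr.inr.inr.inl =>
    exact ofArc nkl.symm njl.symm nil.symm njk.symm nik.symm nij.symm hlk hij
      (tight_trans ha h2 hx hcd hij)
  case inr.inr.inr.inr.inl =>
    exact ofArc nkl.symm njl.symm nil.symm njk.symm nik.symm nij.symm hlk hij hcd
  all_goals exact (hv (by linarith)).elim

theorem exists_remaining : ∀ i l : Fin 4, i ≠ l → ∃ j k, i ≠ j ∧ i ≠ k ∧ j ≠ k ∧ j ≠ l ∧ k ≠ l := by
  decide

theorem exists_vertexTree_subset_tight (ha : IsKleene a)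
    (h2 : ∀ i j, i ≠ j → a i j + a j i < 0) {x : Space} (hx : x ∈ body a)
    (h : Module.finrank ℝ (dir (tight a x)) < 1) :
    ∃ c, vertexTree (orient a) c ⊆ tight a x := by
  obtain ⟨e, he⟩ := exists_edgeForest_subset_tight ha h2 hx (h.trans (by norm_num))
  obtain ⟨⟨c, d⟩, hq, v, hv, hvq⟩ :=
    exists_mem_ne (h.trans_eq (finrank_dir_edgeForest (orient a) e).symm)
  rcases e with ⟨⟨i, l⟩, nil⟩ | ⟨⟨l, i⟩, nli⟩ | m
  · obtain ⟨j, k, nij, nik, njk, njl, nkl⟩ := exists_remaining i l nil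
    have h1 : (i, j) ∈ edgeForest (orient a) (.inl ⟨(i, l), nil⟩) := by
      simp [edgeForest, star, nij.symm, njl]
    have h2' : (i, k) ∈ edgeForest (orient a) (.inl ⟨(i, l), nil⟩) := by
      simp [edgeForest, star, nik.symm, nkl]
    exact exists_vertexTree_of_star ha h2 hx nij nik nil njk njl nkl (he h1) (he h2') hq
      (hv _ h1) (hv _ h2') hvq
  · obtain ⟨j, k, nij, nik, njk, njl, nkl⟩ := exists_remaining i l (Ne.symm nli)
    have h1 : (j, i) ∈ edgeForest (orient a) (.inr (.inl ⟨(l, i), nli⟩)) := by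
      simp [edgeForest, costar, nij.symm, njl]
    have h2' : (k, i) ∈ edgeForest (orient a) (.inr (.inl ⟨(l, i), nli⟩)) := by
      simp [edgeForest, costar, nik.symm, nkl]
    exact exists_vertexTree_of_costar ha h2 hx nij nik (Ne.symm nli) njk njl nkl (he h1) (he h2')
      hq (hv _ h1).symm (hv _ h2').symm hvq
  · obtain ⟨n1, n2, n3, n4, n5, n6⟩ := rows_columns_distinct m
    simp only [edgeForest] at he hv
    rcases ho : orient a m with _ | _ <;> rw [ho] at he hv
    · exact exists_vertexTree_of_matching ha h2 hx n1 n2 n3 n4 n5 n6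
        (he (by simp [matching])) (he (by simp [matching])) hq
        (hv (row₁ m, col₁ m) (by simp [matching])) (hv (row₂ m, col₂ m) (by simp [matching])) hvq
    · exact exists_vertexTree_of_matching ha h2 hx n2 n1 n3 n4.symm n6 n5
        (he (by simp [matching])) (he (by simp [matching])) hq
        (hv (row₁ m, col₂ m) (by simp [matching])) (hv (row₂ m, col₁ m) (by simp [matching])) hvq

variable {P : NonemptyCompacts Space}

theorem faces_zero_subset (ha : IsKleene a) (h2 : ∀ i j, i ≠ j → a i j + a j i < 0)
    (hP : (P : Set Space) = body a) :
    faces 0 P ⊆ Set.range fun c => tightFace a (vertexTree (orient a) c) := by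
  intro F hF
  obtain ⟨x, hx, rfl, hk⟩ := (mem_faces hP).1 hF
  obtain ⟨c, hc⟩ := exists_vertexTree_subset_tight ha h2 hx (by omega)
  exact ⟨c, (tightFace_eq_of_subset hc (by rw [finrank_dir_vertexTree, hk])).symm⟩

theorem faces_one_subset (ha : IsKleene a) (h2 : ∀ i j, i ≠ j → a i j + a j i < 0)
    (hP : (P : Set Space) = body a) :
    faces 1 P ⊆ Set.range fun c => tightFace a (edgeForest (orient a) c) := by
  intro F hF
  obtain ⟨x, hx, rfl, hk⟩ := (mem_faces hP).1 hF
  obtain ⟨c, hc⟩ := exists_edgeForest_subset_tight ha h2 hx (by omega)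
  exact ⟨c, (tightFace_eq_of_subset hc (by rw [finrank_dir_edgeForest, hk])).symm⟩

theorem faces_two_subset (hP : (P : Set Space) = body a) :
    faces 2 P ⊆ Set.range fun p : Arc => tightFace a {p.1} := by
  intro F hF
  obtain ⟨x, hx, rfl, hk⟩ := (mem_faces hP).1 hF
  obtain ⟨p, hp⟩ := exists_arc_subset (by omega : Module.finrank ℝ (dir (tight a x)) < 3)
  exact ⟨p, (tightFace_eq_of_subset hp (by rw [finrank_dir_arc, hk])).symm⟩

theorem encard_range_le {α β : Type*} [Fintype α] (f : α → β) :
    (Set.range f).encard ≤ Fintype.card α := by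
  rw [← Set.image_univ]
  exact (Set.encard_image_le f _).trans (by simp)

/-- No alcoved polyhedron has more than 20 vertices, 30 edges or 12 facets. -/
theorem IsAlcoved.fVec_le (hP : IsAlcoved P) : fVec P ≤ ![20, 30, 12] := by
  obtain ⟨a, ha, h2, hPa⟩ := hP.exists_isKleene
  intro k
  fin_cases k
  · refine (Set.encard_le_encard (faces_zero_subset ha h2 hPa)).trans
      ((encard_range_le _).trans_eq ?_)
    rw [card_vertexLabel]; rfl
  · refine (Set.encard_le_encard (faces_one_subset ha h2 hPa)).trans
      ((encard_range_le _).trans_eq ?_)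
    rw [card_edgeLabel]; rfl
  · refine (Set.encard_le_encard (faces_two_subset hPa)).trans
      ((encard_range_le _).trans_eq ?_)
    rw [card_arc]; rfl

/-! ### Generic Kleene matrices and maximal alcoved polyhedra -/

theorem IsGeneric.add_swap_neg (h : IsGeneric a) (i j : Fin 4) (hij : i ≠ j) :
    a i j + a j i < 0 := by
  have := h.strict i i j hij hij.symm
  rwa [h.diag] at this

theorem mem_body_and_tight_eq {x : Space} {T : Finset (Fin 4 × Fin 4)} (hd : ∀ i, a i i = 0)
    (hne : ∀ p ∈ T, p.1 ≠ p.2) (hT : ∀ p ∈ T, hom x p.1 - hom x p.2 = a p.1 p.2)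
    (hs : ∀ i j, i ≠ j → (i, j) ∉ T → a i j < hom x i - hom x j) :
    x ∈ body a ∧ tight a x = T := by
  refine ⟨fun i j => ?_, ?_⟩
  · rcases eq_or_ne i j with rfl | hij
    · simp [hd]
    by_cases hp : (i, j) ∈ T
    · exact (hT _ hp).ge
    · exact (hs i j hij hp).le
  · ext ⟨i, j⟩
    rw [mem_tight]
    refine ⟨fun h => ?_, fun h => ⟨hne _ h, hT _ h⟩⟩
    by_contra hp
    exact (hs i j h.1 hp).ne' h.2

theorem IsGeneric.tight_rowPoint (h : IsGeneric a) (i : Fin 4) :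
    tight a (rowPoint a i) = star i := by
  refine (mem_body_and_tight_eq h.diag ?_ ?_ ?_).2
  · rintro ⟨c, d⟩ hp
    obtain ⟨rfl, hd⟩ : c = i ∧ d ≠ i := by simpa [star] using hp
    exact hd.symm
  · rintro ⟨c, d⟩ hp
    obtain ⟨rfl, hd⟩ : c = i ∧ d ≠ i := by simpa [star] using hp
    simp [rowPoint, hom_ofHom, h.diag]
  · intro c d hcd hp
    have hci : i ≠ c := by
      rintro rfl; exact hp (by simp [star, hcd.symm])
    have := h.strict i d c hci hcd
    simp only [rowPoint, hom_ofHom]; linarith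

theorem IsGeneric.tight_colPoint (h : IsGeneric a) (j : Fin 4) :
    tight a (colPoint a j) = costar j := by
  refine (mem_body_and_tight_eq h.diag ?_ ?_ ?_).2
  · rintro ⟨c, d⟩ hp
    obtain ⟨rfl, hd⟩ : d = j ∧ c ≠ j := by simpa [costar] using hp
    exact hd
  · rintro ⟨c, d⟩ hp
    obtain ⟨rfl, hd⟩ : d = j ∧ c ≠ j := by simpa [costar] using hp
    simp [colPoint, hom_ofHom, h.diag]
  · intro c d hcd hp
    have hdj : d ≠ j := by
      rintro rfl; exact hp (by simp [costar, hcd])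
    have := h.strict c j d hcd hdj
    simp only [colPoint, hom_ofHom]; linarith

/-- The path with a missing arc in the strictly smaller matching of a minor is realized. -/
theorem IsGeneric.exists_tight_eq_path (h : IsGeneric a) {i j k l : Fin 4} (nij : i ≠ j)
    (nik : i ≠ k) (nil : i ≠ l) (njk : j ≠ k) (njl : j ≠ l) (nkl : k ≠ l)
    (hlt : a i j + a l k < a i k + a l j) : ∃ x ∈ body a, tight a x = path i j k l := by
  obtain ⟨x, hx⟩ := (isTree_path nij nik nil njk njl nkl).exists_diff_eq fun p => a p.1 p.2
  have eij := hx (i, j) (by simp [path])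
  have eik := hx (i, k) (by simp [path])
  have elj := hx (l, j) (by simp [path])
  simp only at eij eik elj
  refine ⟨x, mem_body_and_tight_eq h.diag ?_ hx ?_⟩
  · simp only [path, Finset.mem_insert, Finset.mem_singleton, forall_eq_or_imp, forall_eq]
    exact ⟨nij, nik, njl.symm⟩
  · intro c d hcd hp
    have s1 := h.add_swap_neg i j nij
    have s2 := h.add_swap_neg i k nik
    have s3 := h.add_swap_neg l j njl.symm
    have t1 := h.strict i j l nil njl.symm
    have t2 := h.strict l j i nil.symm nij
    have t3 := h.strict i k j nij njk
    have t4 := h.strict i j k nik njk.symm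
    have t5 := h.strict k j l nkl njl.symm
    rcases eq_or_of_distinct i j k l nij nik nil njk njl nkl c with rfl | rfl | rfl | rfl <;>
      rcases eq_or_of_distinct _ _ _ _ nij nik nil njk njl nkl d with rfl | rfl | rfl | rfl <;>
      first
      | exact (hcd rfl).elim
      | linarith
      | exact (hp (by simp [path])).elim

theorem IsGeneric.exists_tight_eq_vertexTree (h : IsGeneric a) (c : VertexLabel) :
    ∃ x ∈ body a, tight a x = vertexTree (orient a) c := by
  rcases c with i | j | ⟨m, b⟩
  · exact ⟨_, h.isKleene.rowPoint_mem i, h.tight_rowPoint i⟩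
  · exact ⟨_, h.isKleene.colPoint_mem j, h.tight_colPoint j⟩
  · obtain ⟨n1, n2, n3, n4, n5, n6⟩ := rows_columns_distinct m
    have hne := h.minor (row₁ m) (col₁ m) (col₂ m) (row₂ m) n1 n2 n3 n4 n5 n6
    simp only [vertexTree]
    rcases ho : orient a m with _ | _
    · rw [orient_eq_false_iff] at ho
      cases b
      · exact h.exists_tight_eq_path n5.symm n6.symm n3.symm n4 n1.symm n2.symm (by linarith)
      · exact h.exists_tight_eq_path n2 n1 n3 n4.symm n6 n5 (by linarith)
    · rw [orient_eq_true_iff] at ho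
      have ho := lt_of_le_of_ne ho hne
      cases b
      · exact h.exists_tight_eq_path n6.symm n5.symm n3.symm n4.symm n2.symm n1.symm (by linarith)
      · exact h.exists_tight_eq_path n1 n2 n3 n4 n5 n6 (by linarith)

/-- At a simple vertex, any of the tight inequalities can be relaxed. -/
theorem exists_tight_eq_subset {x : Space} (hx : x ∈ body a) (hT : IsTree (tight a x))
    {S : Finset (Fin 4 × Fin 4)} (hS : S ⊆ tight a x) : ∃ y ∈ body a, tight a y = S := by
  obtain ⟨v, hv⟩ := hT.exists_diff_eq fun p => if p ∈ S then 0 else 1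
  obtain ⟨t, hs, ht⟩ := ((eventually_slack hx v).filter_mono nhdsWithin_le_nhds
    |>.and (self_mem_nhdsWithin (s := Set.Ioi (0 : ℝ)))).exists
  have hd : ∀ i, a i i ≤ 0 := fun i => by simpa using hx i i
  have hval : ∀ p ∈ tight a x, hom (x + t • v) p.1 - hom (x + t • v) p.2 =
      a p.1 p.2 + t * if p ∈ S then 0 else 1 := fun p hp => by
    have h1 := hv p hp
    have h2 := (mem_tight.1 hp).2
    simp only [hom_add, hom_smul]
    rw [← h1, ← h2]; ring
  refine ⟨x + t • v, add_smul_mem_body hx ht.le hs fun p hp => ?_, ?_⟩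
  · rw [hv p hp]; split_ifs <;> norm_num
  · ext ⟨i, j⟩
    rw [mem_tight]
    refine ⟨fun h => ?_, fun h => ⟨(mem_tight.1 (hS h)).1, ?_⟩⟩
    · by_contra hp
      by_cases hp' : (i, j) ∈ tight a x
      · have := hval _ hp'
        simp only [hp, if_false] at this
        linarith [h.2]
      · exact (hs i j h.1 hp').ne' h.2
    · have := hval _ (hS h)
      simpa [h] using this

theorem IsGeneric.exists_tight_eq_of_subset_vertexTree (h : IsGeneric a) {c : VertexLabel}
    {S : Finset (Fin 4 × Fin 4)} (hS : S ⊆ vertexTree (orient a) c) :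
    ∃ y ∈ body a, tight a y = S := by
  obtain ⟨x, hx, hxT⟩ := h.exists_tight_eq_vertexTree c
  exact exists_tight_eq_subset hx (hxT ▸ isTree_vertexTree _ c) (hxT ▸ hS)

/-- If each of the systems `T c` is the set of tight inequalities at some point, then they yield
different faces. -/
theorem encard_range_tightFace {ι : Type*} [Fintype ι] {T : ι → Finset (Fin 4 × Fin 4)}
    (hinj : Function.Injective T) (hT : ∀ c, ∃ y ∈ body a, tight a y = T c) :
    (Set.range fun c => tightFace a (T c)).encard = Fintype.card ι := by
  have : Function.Injective fun c => tightFace a (T c) := fun c d hcd => by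
    obtain ⟨x, hx, hxT⟩ := hT c
    obtain ⟨y, hy, hyT⟩ := hT d
    simp only [← hxT, ← hyT] at hcd
    exact hinj (by rw [← hxT, ← hyT, tight_eq_of_tightFace_eq hx hy hcd])
  rw [← Set.image_univ, this.encard_image]; simp

theorem range_subset_faces (hP : (P : Set Space) = body a) {ι : Type*} {k : ℕ}
    {T : ι → Finset (Fin 4 × Fin 4)} (hk : ∀ c, Module.finrank ℝ (dir (T c)) = k)
    (hT : ∀ c, ∃ y ∈ body a, tight a y = T c) :
    (Set.range fun c => tightFace a (T c)) ⊆ faces k P := by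
  rintro _ ⟨c, rfl⟩
  obtain ⟨y, hy, hyT⟩ := hT c
  exact (mem_faces hP).2 ⟨y, hy, by simp only [hyT], by rw [hyT, hk]⟩

theorem IsGeneric.fVec_eq (h : IsGeneric a) (hP : (P : Set Space) = body a) :
    fVec P = ![20, 30, 12] := by
  have hV := h.exists_tight_eq_vertexTree
  have hE : ∀ c, ∃ y ∈ body a, tight a y = edgeForest (orient a) c := fun c => by
    obtain ⟨d, hd⟩ := exists_edgeForest_subset (orient a) c
    exact h.exists_tight_eq_of_subset_vertexTree hd
  have hF : ∀ p : Arc, ∃ y ∈ body a, tight a y = {p.1} := fun p =>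
    h.exists_tight_eq_of_subset_vertexTree (c := .inl p.1.1) (arc_subset_star p)
  funext k
  fin_cases k
  · change (faces 0 P).encard = 20
    rw [(faces_zero_subset h.isKleene h.add_swap_neg hP).antisymm
      (range_subset_faces hP (finrank_dir_vertexTree _) hV),
      encard_range_tightFace (vertexTree_injective _) hV, card_vertexLabel]
    rfl
  · change (faces 1 P).encard = 30
    rw [(faces_one_subset h.isKleene h.add_swap_neg hP).antisymm
      (range_subset_faces hP (finrank_dir_edgeForest _) hE),
      encard_range_tightFace (edgeForest_injective _) hE, card_edgeLabel]
    rfl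
  · change (faces 2 P).encard = 12
    rw [(faces_two_subset hP).antisymm (range_subset_faces hP finrank_dir_arc hF),
      encard_range_tightFace (fun p q hpq => Subtype.ext (Finset.singleton_injective hpq)) hF,
      card_arc]
    rfl

/-- The edges at a vertex correspond to the three subsystems with two elements of the tree of
inequalities tight at the vertex. -/
theorem IsGeneric.isSimple (h : IsGeneric a) (hP : (P : Set Space) = body a) : IsSimple P := by
  intro V hV
  obtain ⟨c, hc⟩ := faces_zero_subset h.isKleene h.add_swap_neg hP hV
  obtain ⟨x, hx, hxT⟩ := h.exists_tight_eq_vertexTree c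
  have hTree : IsTree (tight a x) := hxT ▸ isTree_vertexTree _ c
  replace hc : V = tightFace a (tight a x) := by rw [hxT]; exact hc.symm
  have hiff : ∀ S : Finset (Fin 4 × Fin 4), S ⊆ tight a x → V ⊆ tightFace a S := fun S hS y hy => by
    rw [hc] at hy
    exact ⟨hy.1, fun p hp => hy.2 p (hS hp)⟩
  have hreal : ∀ S : Finset (Fin 4 × Fin 4), S ⊆ tight a x → ∃ y ∈ body a, tight a y = S :=
    fun S hS => exists_tight_eq_subset hx hTree hS
  have heq : {e ∈ faces 1 P | V ⊆ e} =
      tightFace a '' ((tight a x).powersetCard 2 : Finset (Finset (Fin 4 × Fin 4))) := by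
    ext e
    simp only [Set.mem_ofPred_eq, Set.mem_image, Finset.mem_coe, Finset.mem_powersetCard]
    constructor
    · rintro ⟨he, hVe⟩
      obtain ⟨y, hy, rfl, hk⟩ := (mem_faces hP).1 he
      have hsub : tight a y ⊆ tight a x :=
        (mem_tightFace_tight_iff.1 (hVe (hc ▸ self_mem_tightFace hx))).2
      rw [hTree.finrank_dir hsub] at hk
      have := Finset.card_le_card hsub
      exact ⟨_, ⟨hsub, by have := hTree.card; omega⟩, rfl⟩
    · rintro ⟨S, ⟨hS, hcard⟩, rfl⟩
      obtain ⟨y, hy, rfl⟩ := hreal S hS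
      exact ⟨(mem_faces hP).2 ⟨y, hy, rfl, by rw [hTree.finrank_dir hS, hcard]⟩, hiff _ hS⟩
  rw [heq, Set.InjOn.encard_image, Set.encard_coe_eq_coe_finsetCard, Finset.card_powersetCard,
    hTree.card]
  · rfl
  · intro S hS T hT hST
    obtain ⟨y, hy, rfl⟩ := hreal S (Finset.mem_powersetCard.1 hS).1
    obtain ⟨z, hz, rfl⟩ := hreal T (Finset.mem_powersetCard.1 hT).1
    exact tight_eq_of_tightFace_eq hy hz hST

theorem IsGeneric.isAlcoved (h : IsGeneric a) (hP : (P : Set Space) = body a) : IsAlcoved P := by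
  refine ⟨?_, a, hP⟩
  obtain ⟨y, hy, hyT⟩ := h.exists_tight_eq_of_subset_vertexTree (c := .inl 0)
    (Finset.empty_subset _)
  have hopen : IsOpen {x | ∀ i j, i ≠ j → a i j < hom x i - hom x j} := by
    simp only [Set.ofPred_forall]
    exact isOpen_iInter_of_finite fun i => isOpen_iInter_of_finite fun j =>
      isOpen_iInter_of_finite fun _ =>
        isOpen_lt continuous_const ((continuous_hom i).sub (continuous_hom j))
  refine ⟨y, mem_interior.2 ⟨_, fun x hx => ?_, hopen, fun i j hij => ?_⟩⟩
  · rw [hP]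
    intro i j
    rcases eq_or_ne i j with rfl | hij
    · simp [h.diag]
    · exact (hx i j hij).le
  · refine lt_of_le_of_ne (hy i j) fun he => ?_
    have : (i, j) ∈ tight a y := mem_tight.2 ⟨hij, he.symm⟩
    simp [hyT] at this

theorem encard_lt_of_subset_image {α β : Type*} [Fintype α] {f : α → β} {s : Set β}
    (hs : s ⊆ Set.range f) {c : α} (hc : ∀ b ∈ s, b = f c → ∃ d ≠ c, f d = b) :
    s.encard < Fintype.card α := by
  classical
  have hsub : s ⊆ f '' ((Finset.univ.erase c : Finset α) : Set α) := by
    intro b hb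
    obtain ⟨d, rfl⟩ := hs hb
    by_cases hd : d = c
    · subst hd
      obtain ⟨e, he, hfe⟩ := hc _ hb rfl
      exact ⟨e, by simp [he], hfe⟩
    · exact ⟨d, by simp [hd], rfl⟩
  refine lt_of_le_of_lt ((Set.encard_le_encard hsub).trans (Set.encard_image_le _ _)) ?_
  rw [Set.encard_coe_eq_coe_finsetCard, Nat.cast_lt]
  exact Finset.card_lt_card (Finset.erase_ssubset (Finset.mem_univ c))

/-- Missing facets or vertices witness the failure of genericity. -/
theorem isGeneric_of_fVec_eq (ha : IsKleene a) (h2 : ∀ i j, i ≠ j → a i j + a j i < 0)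
    (hP : (P : Set Space) = body a) (hf : fVec P = ![20, 30, 12]) : IsGeneric a where
  diag := ha.diag
  strict i j k hik hkj := by
    rcases eq_or_ne i j with rfl | hij
    · rw [ha.diag]; exact h2 i k hik
    refine lt_of_le_of_ne (ha.idem i j k) fun heq => ?_
    have h12 : (faces 2 P).encard = 12 := congr_fun hf 2
    refine (encard_lt_of_subset_image (faces_two_subset hP)
      (c := (⟨(i, j), hij⟩ : Arc)) fun F hF hFe => ?_).ne (by rw [h12, card_arc]; rfl)
    exfalso
    obtain ⟨x, hx, rfl, hk⟩ := (mem_faces hP).1 hF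
    have hxij : hom x i - hom x j = a i j :=
      (hFe ▸ self_mem_tightFace hx : x ∈ tightFace a {(i, j)}).2 (i, j) (by simp)
    have hxik := hx i k
    have hxkj := hx k j
    obtain ⟨l, nil, njl, nkl⟩ := exists_fourth i j k hij hik hkj.symm
    have hsub : edgeForest (orient a) (.inl ⟨(i, l), nil⟩) ⊆ tight a x :=
      star_erase_subset_of hij hik nil hkj.symm njl nkl (mem_tight.2 ⟨hij, hxij⟩)
        (mem_tight.2 ⟨hik, by linarith⟩)
    have := Submodule.finrank_mono (dir_anti hsub)
    rw [finrank_dir_edgeForest] at this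
    omega
  minor i j k l nij nik nil njk njl nkl := fun heq => by
    have h20 : (faces 0 P).encard = 20 := congr_fun hf 0
    obtain ⟨m, hm⟩ := exists_minor_of_distinct i j k l nij nik nil njk njl nkl
    have hmin : a (row₁ m) (col₁ m) + a (row₂ m) (col₂ m) =
        a (row₁ m) (col₂ m) + a (row₂ m) (col₁ m) := by
      rcases hm with ⟨h1, h2, h3, h4⟩ | ⟨h1, h2, h3, h4⟩ | ⟨h1, h2, h3, h4⟩ | ⟨h1, h2, h3, h4⟩ <;>
        rw [h1, h2, h3, h4] <;> linarith
    refine (encard_lt_of_subset_image (faces_zero_subset ha h2 hP)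
      (c := (.inr (.inr (m, true)))) fun F _ hFe =>
        ⟨.inr (.inr (m, false)), by simp, ?_⟩).ne (by rw [h20, card_vertexLabel]; rfl)
    rw [hFe]
    simp only [vertexTree, orient_eq_true_iff.2 hmin.le]
    ext x
    simp only [tightFace, pathOf, path, Set.mem_ofPred_eq, Finset.mem_insert,
      Finset.mem_singleton, forall_eq_or_imp, forall_eq]
    refine and_congr_right fun _ => ⟨fun ⟨e1, e2, e3⟩ => ?_, fun ⟨e1, e2, e3⟩ => ?_⟩ <;>
      refine ⟨?_, ?_, ?_⟩ <;> linarith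

/-- The alcoved polyhedron of a matrix, as a nonempty compact set. -/
def IsKleene.toNonemptyCompacts (ha : IsKleene a) : NonemptyCompacts Space :=
  ⟨⟨body a, isCompact_body a⟩, ⟨_, ha.colPoint_mem 0⟩⟩

@[simp] theorem IsKleene.coe_toNonemptyCompacts (ha : IsKleene a) :
    (ha.toNonemptyCompacts : Set Space) = body a := rfl

/-! ### Difference tuples as tropical minors -/

/-- The tropical minors of order two that avoid the diagonal. For a visualized idempotent matrix
they are the entries of the difference tuple. -/
def sqMinor (a : Matrix (Fin 4) (Fin 4) ℝ) (m : Fin 6) : ℝ :=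
  a (row₁ m) (col₁ m) + a (row₂ m) (col₂ m) - a (row₁ m) (col₂ m) - a (row₂ m) (col₁ m)

theorem IsVisualizedIdempotent.difference_eq {A : Matrix (Fin 4) (Fin 4) ℝ}
    (hA : IsVisualizedIdempotent A) (m : Fin 6) : difference A m = sqMinor A m := by
  have h0 := hA.lastRow 0
  have h1 := hA.lastRow 1
  have h2 := hA.lastRow 2
  fin_cases m <;>
    simp [difference, cant, perturbationMatrix, sqMinor, row₁, row₂, col₁, col₂] <;> linarith

theorem sqMinor_eq_of_translate {A : Matrix (Fin 4) (Fin 4) ℝ} {v : Fin 4 → ℝ}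
    (h : ∀ i j, a i j = A i j + (v i - v j)) (m : Fin 6) : sqMinor a m = sqMinor A m := by
  simp only [sqMinor, h]; ring

theorem sum_sqMinor (a : Matrix (Fin 4) (Fin 4) ℝ) : ∑ m, sqMinor a m = 0 := by
  simp [Fin.sum_univ_six, sqMinor, row₁, row₂, col₁, col₂]
  ring

theorem IsGeneric.sqMinor_ne_zero (h : IsGeneric a) (m : Fin 6) : sqMinor a m ≠ 0 := by
  obtain ⟨n1, n2, n3, n4, n5, n6⟩ := rows_columns_distinct m
  have := h.minor (row₁ m) (col₁ m) (col₂ m) (row₂ m) n1 n2 n3 n4 n5 n6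
  intro h0
  apply this
  rw [sqMinor] at h0
  linarith

theorem isGeneric_of_minor (hd : ∀ i, a i i = 0)
    (hs : ∀ i j k, i ≠ k → k ≠ j → a i k + a k j < a i j) (hm : ∀ m, sqMinor a m ≠ 0) :
    IsGeneric a where
  diag := hd
  strict := hs
  minor i j k l nij nik nil njk njl nkl heq := by
    obtain ⟨m, h⟩ := exists_minor_of_distinct i j k l nij nik nil njk njl nkl
    apply hm m
    rw [sqMinor]
    rcases h with ⟨h1, h2, h3, h4⟩ | ⟨h1, h2, h3, h4⟩ | ⟨h1, h2, h3, h4⟩ | ⟨h1, h2, h3, h4⟩ <;>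
      rw [h1, h2, h3, h4] <;> linarith

/-- The entries of `f` are nonzero and have the signs `s`. -/
def SignsOf (f : Fin 6 → ℝ) (s : SignTuple) : Prop :=
  ∀ i, 0 < (((s.1 i : ℤˣ) : ℤ) : ℝ) * f i

theorem SignsOf.ne_zero {f : Fin 6 → ℝ} {s : SignTuple} (h : SignsOf f s) (i : Fin 6) :
    f i ≠ 0 := by
  intro h0
  have := h i
  simp [h0] at this

theorem SignsOf.pos_iff {f : Fin 6 → ℝ} {s : SignTuple} (h : SignsOf f s) (i : Fin 6) :
    0 < f i ↔ s.1 i = 1 := by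
  have := h i
  rcases Int.units_eq_one_or (s.1 i) with hs | hs
  · simpa [hs] using this
  · rw [hs] at this ⊢
    simp only [Units.val_neg, Units.val_one, Int.cast_neg, Int.cast_one] at this
    constructor
    · intro h; linarith
    · intro h; exact absurd h (by decide)

theorem SignsOf.unique {f g : Fin 6 → ℝ} {s t : SignTuple} (h : SignsOf f s) (h' : SignsOf g t)
    (hfg : ∀ i, 0 < f i ↔ 0 < g i) : s = t := by
  apply Subtype.ext
  funext i
  have hi := (h.pos_iff i).symm.trans ((hfg i).trans (h'.pos_iff i))
  rcases Int.units_eq_one_or (s.1 i) with hs | hs <;>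
    rcases Int.units_eq_one_or (t.1 i) with ht | ht <;> rw [hs, ht] at hi ⊢ <;>
    revert hi <;> decide

theorem SignsOf.congr {f g : Fin 6 → ℝ} {s : SignTuple} (h : SignsOf f s)
    (hfg : ∀ i, ∃ c : ℝ, 0 < c ∧ g i = c * f i) : SignsOf g s := fun i => by
  obtain ⟨c, hc, he⟩ := hfg i
  rw [he, mul_left_comm]
  exact mul_pos hc (h i)

/-- A tuple without zeros whose sum vanishes has a nonconstant sign tuple. -/
theorem exists_signsOf {f : Fin 6 → ℝ} (h0 : ∀ i, f i ≠ 0) (hsum : ∑ i, f i = 0) :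
    ∃ s, SignsOf f s := by
  classical
  let s : Fin 6 → ℤˣ := fun i => if 0 < f i then 1 else -1
  have hs : ∀ i, 0 < (((s i : ℤˣ) : ℤ) : ℝ) * f i := fun i => by
    by_cases hi : 0 < f i
    · simp [s, hi]
    · have := lt_of_le_of_ne (not_lt.1 hi) (h0 i)
      simp [s, hi, this]
  refine ⟨⟨s, fun hc => ?_⟩, hs⟩
  have hpos : 0 < ∑ i, (((s i : ℤˣ) : ℤ) : ℝ) * f i :=
    Finset.sum_pos (fun i _ => hs i) Finset.univ_nonempty
  rw [Finset.sum_congr rfl fun i _ => by rw [hc i 0], ← Finset.mul_sum, hsum, mul_zero] at hpos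
  exact hpos.false

theorem IsGeneric.exists_signsOf (h : IsGeneric a) : ∃ s, SignsOf (sqMinor a) s :=
  Alcoved.exists_signsOf h.sqMinor_ne_zero (sum_sqMinor a)

/-! ### Generic matrices inside the cube with prescribed signs -/

/-- The Kleene matrix of the cube `[-1, 1]³` with the six edges disjoint from the polar axis cut
off at the depths `z`, in the order of the cant tuple. -/
def cantMatrix (z : Fin 6 → ℝ) : Matrix (Fin 4) (Fin 4) ℝ :=
  !![0, -2 + z 2, -2 + z 1, -1;
     -2 + z 5, 0, -2 + z 0, -1;
     -2 + z 4, -2 + z 3, 0, -1;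
     -1, -1, -1, 0]

theorem sqMinor_cantMatrix (z : Fin 6 → ℝ) (m : Fin 6) :
    sqMinor (cantMatrix z) m = z m - z (m + 1) := by
  fin_cases m <;> simp [sqMinor, row₁, row₂, col₁, col₂, cantMatrix] <;> ring

theorem isGeneric_cantMatrix {z : Fin 6 → ℝ} (h0 : ∀ i, 0 < z i) (h1 : ∀ i, z i < 1)
    (hz : ∀ i, z i ≠ z (i + 1)) : IsGeneric (cantMatrix z) := by
  refine isGeneric_of_minor (fun i => ?_) (fun i j k hik hkj => ?_) fun m => ?_
  · fin_cases i <;> simp [cantMatrix]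
  · have a0 := h0 0
    have a1 := h0 1
    have a2 := h0 2
    have a3 := h0 3
    have a4 := h0 4
    have a5 := h0 5
    have b0 := h1 0
    have b1 := h1 1
    have b2 := h1 2
    have b3 := h1 3
    have b4 := h1 4
    have b5 := h1 5
    fin_cases i <;> fin_cases k <;> first | exact absurd rfl hik | skip
    all_goals
      fin_cases j <;> first | exact absurd rfl hkj | skip
    all_goals simp [cantMatrix]
    all_goals linarith
  · rw [sqMinor_cantMatrix, sub_ne_zero]
    exact hz m

/-- Partial sums of a tuple with the signs `s` and with vanishing total sum. -/
def heights (s : Fin 6 → ℤˣ) (i : Fin 6) : ℤ :=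
  ∑ j with j < i, (s j : ℤ) * (Finset.univ.filter fun k => s k ≠ s j).card

/-- The bounds are only needed to scale the heights into an interval of length one. -/
theorem heights_spec : ∀ s : Fin 6 → ℤˣ, (¬ ∀ i j, s i = s j) →
    ∀ i, 0 < (s i : ℤ) * (heights s (i + 1) - heights s i) ∧
      -40 < heights s i ∧ heights s i < 40 := by
  decide +kernel

/-- All nonconstant sign tuples are realized inside the cube. -/
theorem exists_cantMatrix_signsOf (s : SignTuple) :
    ∃ z, IsGeneric (cantMatrix z) ∧ SignsOf (sqMinor (cantMatrix z)) s := by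
  have h := heights_spec s.1 s.2
  set z : Fin 6 → ℝ := fun i => 1 / 2 - (heights s.1 i : ℝ) / 100 with hz
  have hs : SignsOf (sqMinor (cantMatrix z)) s := fun i => by
    have h1 : (0 : ℝ) < (((s.1 i : ℤˣ) : ℤ) : ℝ) * (heights s.1 (i + 1) - heights s.1 i) := by
      exact_mod_cast (h i).1
    rw [sqMinor_cantMatrix, hz]
    have : (1 / 2 - (heights s.1 i : ℝ) / 100 - (1 / 2 - (heights s.1 (i + 1) : ℝ) / 100)) =
      (heights s.1 (i + 1) - heights s.1 i) / 100 := by ring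
    simp only [this, mul_div_assoc']
    positivity
  refine ⟨z, isGeneric_cantMatrix (fun i => ?_) (fun i => ?_) (fun i he => ?_), hs⟩
  · have : (heights s.1 i : ℝ) < 40 := by exact_mod_cast (h i).2.2
    simp only [hz]; linarith
  · have : (-40 : ℝ) < heights s.1 i := by exact_mod_cast (h i).2.1
    simp only [hz]; linarith
  · apply hs.ne_zero i
    rw [sqMinor_cantMatrix, sub_eq_zero]
    exact he

/-! ### Maximal alcoved polyhedra and their matrices -/

theorem exists_isGeneric : ∃ a, IsGeneric a := by
  obtain ⟨z, hz, -⟩ := exists_cantMatrix_signsOf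
    ⟨fun i => if i = 0 then 1 else -1, fun h => absurd (h 0 1) (by decide)⟩
  exact ⟨_, hz⟩

theorem isGreatest_fVec : IsGreatest (fVec '' {P | IsAlcoved P}) ![20, 30, 12] := by
  obtain ⟨a, ha⟩ := exists_isGeneric
  refine ⟨⟨ha.isKleene.toNonemptyCompacts, ha.isAlcoved rfl, ha.fVec_eq rfl⟩, ?_⟩
  rintro _ ⟨P, hP, rfl⟩
  exact hP.fVec_le

theorem mem_maximalAlcoved_iff_fVec :
    P ∈ maximalAlcoved ↔ IsAlcoved P ∧ fVec P = ![20, 30, 12] := by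
  obtain ⟨⟨Q, hQ, hQf⟩, hub⟩ := isGreatest_fVec
  constructor
  · intro hP
    refine ⟨hP.prop, le_antisymm hP.prop.fVec_le ?_⟩
    rw [← hQf]
    exact hP.2 hQ (hQf ▸ hP.prop.fVec_le)
  · rintro ⟨hP, hPf⟩
    exact ⟨hP, fun R hR _ => hPf ▸ hR.fVec_le⟩

/-- The maximal alcoved polyhedra are those defined by generic Kleene matrices. -/
theorem mem_maximalAlcoved_iff :
    P ∈ maximalAlcoved ↔ ∃ a, IsGeneric a ∧ (P : Set Space) = body a := by
  rw [mem_maximalAlcoved_iff_fVec]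
  constructor
  · rintro ⟨hP, hPf⟩
    obtain ⟨a, ha, h2, hPa⟩ := hP.exists_isKleene
    exact ⟨a, isGeneric_of_fVec_eq ha h2 hPa hPf, hPa⟩
  · rintro ⟨a, ha, hPa⟩
    exact ⟨ha.isAlcoved hPa, ha.fVec_eq hPa⟩

theorem isSimple_of_mem_maximalAlcoved (hP : P ∈ maximalAlcoved) : IsSimple P := by
  obtain ⟨a, ha, hPa⟩ := mem_maximalAlcoved_iff.1 hP
  exact ha.isSimple hPa

theorem IsNormalIdempotent.isKleene {A : Matrix (Fin 4) (Fin 4) ℝ} (hA : IsNormalIdempotent A) :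
    IsKleene A := ⟨hA.diag, hA.idem⟩

/-- Values of the tropical linear map given by a Kleene matrix satisfy the inequalities. -/
theorem IsKleene.le_iSup_sub_iSup (ha : IsKleene a) (w : Fin 4 → ℝ) (i j : Fin 4) :
    a i j ≤ (⨆ k, (w k + a i k)) - ⨆ k, (w k + a j k) := by
  rw [le_sub_iff_add_le, ← le_sub_iff_add_le']
  refine ciSup_le fun k => ?_
  have h1 := ha.idem i k j
  have h2 : w k + a i k ≤ ⨆ k, (w k + a i k) :=
    le_ciSup (f := fun k => w k + a i k) (Set.finite_range _).bddAbove k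
  linarith

theorem IsKleene.iSup_eq_of_mem_body (ha : IsKleene a) {x : Space} (hx : x ∈ body a) (i : Fin 4) :
    ⨆ k, (hom x k + a i k) = hom x i := by
  refine le_antisymm (ciSup_le fun k => ?_) ?_
  · have := hx i k
    linarith
  · refine le_trans ?_ (le_ciSup (f := fun k => hom x k + a i k) (Set.finite_range _).bddAbove i)
    simp [ha.diag]

theorem IsKleene.tropicalSection_eq (ha : IsKleene a) : tropicalSection a = body a := by
  ext x
  constructor
  · rintro ⟨w, hw⟩ i j
    rw [hw, hw]
    exact ha.le_iSup_sub_iSup w i j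
  · intro hx
    exact ⟨hom x, fun i => (ha.iSup_eq_of_mem_body hx i).symm⟩

theorem Represents.matrix_eq {A : Matrix (Fin 4) (Fin 4) ℝ} (hA : Represents A P) (ha : IsKleene a)
    (hP : (P : Set Space) = body a) : ∃ v : Fin 4 → ℝ, ∀ i j, a i j = A i j + (v i - v j) := by
  obtain ⟨hA, v, hv⟩ := hA
  have hK := hA.toIsNormalIdempotent.isKleene
  rw [hP, hK.tropicalSection_eq] at hv
  exact ⟨_, ha.eq_of_body_eq_translate hK hv⟩

theorem existsUnique_represents (hP : P ∈ maximalAlcoved) : ∃! A, Represents A P := by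
  obtain ⟨a, ha, hPa⟩ := mem_maximalAlcoved_iff.1 hP
  -- the last row vanishes after translating the top vertex of the bounding box to the origin
  set A : Matrix (Fin 4) (Fin 4) ℝ := fun i j => a i j + (a 3 i - a 3 j) with hAdef
  have hK : IsKleene A :=
    ⟨fun i => by simp [hAdef, ha.diag], fun i j k => by
      have := ha.isKleene.idem i j k
      simp only [hAdef]; linarith⟩
  have hA : IsVisualizedIdempotent A :=
    { diag := hK.diag
      idem := hK.idem
      lastRow := fun j => by simp [hAdef, ha.diag]
      nonpos := fun i j => by
        have := ha.isKleene.idem 3 j i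
        simp only [hAdef]; linarith }
  refine ⟨A, ⟨hA, ofHom fun k => -a 3 k, ?_⟩, fun B hB => ?_⟩
  · rw [hPa, hK.tropicalSection_eq]
    ext x
    constructor
    · intro hx
      refine ⟨x - ofHom fun k => -a 3 k, fun i j => ?_, by simp⟩
      have := hx i j
      simp only [hom_sub, hom_ofHom, hAdef]; linarith
    · rintro ⟨y, hy, rfl⟩ i j
      have := hy i j
      simp only [hom_add, hom_ofHom, hAdef] at this ⊢; linarith
  · obtain ⟨v, hv⟩ := hB.matrix_eq ha.isKleene hPa
    ext i j
    have h1 := hv i j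
    have h2 := hv 3 i
    have h3 := hv 3 j
    rw [hB.1.lastRow] at h2 h3
    simp only [hAdef]; linarith

theorem Represents.difference_eq {A : Matrix (Fin 4) (Fin 4) ℝ} (hA : Represents A P)
    (ha : IsKleene a) (hP : (P : Set Space) = body a) : difference A = sqMinor a := by
  obtain ⟨v, hv⟩ := hA.matrix_eq ha hP
  funext m
  rw [hA.1.difference_eq, sqMinor_eq_of_translate hv]

theorem exists_hasSigns (hP : P ∈ maximalAlcoved) {A : Matrix (Fin 4) (Fin 4) ℝ}
    (hA : Represents A P) : ∃ s : SignTuple, HasSigns A s := by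
  obtain ⟨a, ha, hPa⟩ := mem_maximalAlcoved_iff.1 hP
  obtain ⟨s, hs⟩ := ha.exists_signsOf
  exact ⟨s, fun i => by rw [hA.difference_eq ha.isKleene hPa]; exact hs i⟩

/-! ### Bounding boxes -/

theorem lo_eq (ha : IsKleene a) (hP : (P : Set Space) = body a) (i : Fin 3) :
    lo P i = a i.castSucc 3 := by
  have h := (ha.isLeast i.castSucc 3).csInf_eq
  simpa [lo, hP] using h

theorem hi_eq (ha : IsKleene a) (hP : (P : Set Space) = body a) (i : Fin 3) :
    hi P i = - a 3 i.castSucc := by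
  refine IsGreatest.csSup_eq ⟨?_, ?_⟩
  · obtain ⟨x, hx, he⟩ := (ha.isLeast 3 i.castSucc).1
    exact ⟨x, hP ▸ hx, by simp at he; simp only; linarith⟩
  · rintro _ ⟨x, hx, rfl⟩
    rw [hP] at hx
    have := hx 3 i.castSucc
    simp at this
    simp only; linarith

/-! ### Normalized bodies and their symmetries -/

/-- Side lengths of the bounding box of `body a`. -/
def side (a : Matrix (Fin 4) (Fin 4) ℝ) (i : Fin 3) : ℝ := - a 3 i.castSucc - a i.castSucc 3

/-- The affine map that takes the bounding box of `body a` onto the cube. -/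
noncomputable def cubePt (a : Matrix (Fin 4) (Fin 4) ℝ) (x : Space) : Space :=
  fun i => 2 * (x i - a i.castSucc 3) / side a i - 1

/-- The image of `body a` under the affine map that takes its bounding box onto the cube. -/
def cubeBody (a : Matrix (Fin 4) (Fin 4) ℝ) : Set Space := cubePt a '' body a

theorem coe_toCube {P : NonemptyCompacts Space} (ha : IsKleene a) (hP : (P : Set Space) = body a) :
    (toCube P : Set Space) = cubeBody a := by
  rw [toCube, NonemptyCompacts.coe_map, hP, cubeBody]
  congr 1
  funext x i
  simp only [boxMap, cubePt, lo_eq ha hP, hi_eq ha hP, side]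

theorem castSucc_ne_three : ∀ i : Fin 3, i.castSucc ≠ 3 := by decide

theorem IsGeneric.side_pos (h : IsGeneric a) (i : Fin 3) : 0 < side a i := by
  have := h.add_swap_neg _ _ (castSucc_ne_three i)
  simp only [side]; linarith

theorem IsGeneric.transpose (h : IsGeneric a) : IsGeneric a.transpose where
  diag := h.diag
  strict i j k hik hkj := by
    have := h.strict j i k hkj.symm hik.symm
    simp only [Matrix.transpose_apply]; linarith
  minor i j k l nij nik nil njk njl nkl := by
    have := h.minor j i l k nij.symm njl njk nil nik nkl.symm
    simp only [Matrix.transpose_apply]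
    intro he
    apply this
    linarith

theorem IsGeneric.submatrix (h : IsGeneric a) {f : Fin 4 → Fin 4} (hf : Function.Injective f) :
    IsGeneric (a.submatrix f f) where
  diag _ := h.diag _
  strict _ _ _ hik hkj := h.strict _ _ _ (hf.ne hik) (hf.ne hkj)
  minor _ _ _ _ nij nik nil njk njl nkl := h.minor _ _ _ _ (hf.ne nij) (hf.ne nik) (hf.ne nil)
    (hf.ne njk) (hf.ne njl) (hf.ne nkl)

theorem hom_neg (x : Space) (i : Fin 4) : hom (-x) i = - hom x i := by
  rw [← homLin_apply, map_neg, homLin_apply]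

theorem neg_mem_body_transpose_iff {x : Space} : -x ∈ body a.transpose ↔ x ∈ body a := by
  simp only [mem_body, hom_neg, Matrix.transpose_apply]
  constructor <;> intro h i j <;> have := h j i <;> linarith

theorem cubePt_transpose_neg (h : IsGeneric a) (x : Space) :
    cubePt a.transpose (-x) = - cubePt a x := by
  funext i
  have hs := (h.side_pos i).ne'
  have hs' : side a.transpose i = side a i := by
    simp only [side, Matrix.transpose_apply]; ring
  simp only [cubePt, hs', Pi.neg_apply, Matrix.transpose_apply]
  field_simp
  simp only [side]
  ring

theorem IsGeneric.neg_image_cubeBody (h : IsGeneric a) :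
    (fun x : Space => -x) '' cubeBody a = cubeBody a.transpose := by
  ext y
  constructor
  · rintro ⟨_, ⟨x, hx, rfl⟩, rfl⟩
    exact ⟨-x, neg_mem_body_transpose_iff.2 hx, cubePt_transpose_neg h x⟩
  · rintro ⟨x, hx, rfl⟩
    refine ⟨_, ⟨-x, neg_mem_body_transpose_iff.1 (by rwa [neg_neg]), rfl⟩, ?_⟩
    simp only [← cubePt_transpose_neg h, neg_neg]

/-- A permutation of the first three indices, as a self-map of the four homogeneous indices. -/
def extend (τ : Equiv.Perm (Fin 3)) : Fin 4 → Fin 4 :=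
  Fin.snoc (α := fun _ => Fin 4) (fun i => (τ i).castSucc) 3

@[simp] theorem extend_castSucc (τ : Equiv.Perm (Fin 3)) (i : Fin 3) :
    extend τ i.castSucc = (τ i).castSucc := by
  simp [extend]

@[simp] theorem extend_three (τ : Equiv.Perm (Fin 3)) : extend τ 3 = 3 := rfl

theorem extend_extend_inv (τ : Equiv.Perm (Fin 3)) (i : Fin 4) : extend τ (extend τ⁻¹ i) = i := by
  induction i using Fin.lastCases with
  | last => rfl
  | cast i => simp

theorem extend_injective (τ : Equiv.Perm (Fin 3)) : Function.Injective (extend τ) := by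
  have := extend_extend_inv τ⁻¹
  rw [inv_inv] at this
  exact Function.LeftInverse.injective this

theorem hom_comp_perm (x : Space) (τ : Equiv.Perm (Fin 3)) (i : Fin 4) :
    hom (x ∘ τ) i = hom x (extend τ i) := by
  induction i using Fin.lastCases with
  | last => rfl
  | cast i => simp

theorem comp_perm_mem_body_iff {x : Space} {τ : Equiv.Perm (Fin 3)} :
    x ∘ τ ∈ body (a.submatrix (extend τ) (extend τ)) ↔ x ∈ body a := by
  simp only [mem_body, hom_comp_perm, Matrix.submatrix_apply]
  constructor
  · intro h i j
    have := h (extend τ⁻¹ i) (extend τ⁻¹ j)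
    rwa [extend_extend_inv, extend_extend_inv] at this
  · intro h i j
    exact h _ _

theorem cubePt_submatrix_comp (x : Space) (τ : Equiv.Perm (Fin 3)) :
    cubePt (a.submatrix (extend τ) (extend τ)) (x ∘ τ) = cubePt a x ∘ τ := by
  funext i
  simp [cubePt, side]

theorem comp_perm_image_cubeBody (a : Matrix (Fin 4) (Fin 4) ℝ) (τ : Equiv.Perm (Fin 3)) :
    (fun x : Space => x ∘ τ) '' cubeBody a = cubeBody (a.submatrix (extend τ) (extend τ)) := by
  ext y
  constructor
  · rintro ⟨_, ⟨x, hx, rfl⟩, rfl⟩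
    exact ⟨x ∘ τ, comp_perm_mem_body_iff.2 hx, cubePt_submatrix_comp x τ⟩
  · rintro ⟨x, hx, rfl⟩
    have he : (x ∘ τ.symm) ∘ τ = x := by funext i; simp
    refine ⟨_, ⟨x ∘ τ.symm, comp_perm_mem_body_iff.1 (by rwa [he]), rfl⟩, ?_⟩
    simp only [← cubePt_submatrix_comp, he]

/-- The sign of a cube symmetry as a signed permutation of the coordinates. -/
def coordSign (g : CubeGroup) : ℤˣ := g.1 * Equiv.Perm.sign g.2

theorem cubeSym_eq_of_one {g : CubeGroup} (hg : coordSign g = 1) :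
    cubeSym g = fun x : Space => x ∘ ⇑g.2⁻¹ := by
  funext x i
  have : g.1 * Equiv.Perm.sign g.2 = 1 := hg
  simp [cubeSym, this]

theorem cubeSym_eq_of_neg_one {g : CubeGroup} (hg : coordSign g = -1) :
    cubeSym g = (fun x : Space => -x) ∘ fun x : Space => x ∘ ⇑g.2⁻¹ := by
  funext x i
  have : g.1 * Equiv.Perm.sign g.2 = -1 := hg
  simp [cubeSym, this]

/-! ### The signs of the minors as geometric invariants

The sign of a minor of `a` is that of the difference between the greatest values of a coordinate on
two facets of the normalized body. These greatest values are compatible with the symmetries of the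
cube. -/

/-- The six signed coordinates of the cube. -/
abbrev SignedAxis := Fin 3 × ℤˣ

/-- The greatest value of the signed coordinate `p` on the facet of the cube where the signed
coordinate `q` equals one. -/
noncomputable def facetMax (K : Set Space) (p q : SignedAxis) : ℝ :=
  sSup ((fun x : Space => ((p.2 : ℤ) : ℝ) * x p.1) '' {x ∈ K | ((q.2 : ℤ) : ℝ) * x q.1 = 1})

/-- Comparison of the greatest values of the signed coordinate `p` on two of the facets adjacent to
the facet in direction `p`. -/
noncomputable def axisDiff (K : Set Space) (p : SignedAxis) : ℝ :=
  facetMax K p (p.1 + 1, -p.2) - facetMax K p (p.1 - 1, -p.2)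

theorem facetMax_cubeSym (K : Set Space) (g : CubeGroup) (p q : SignedAxis) :
    facetMax (cubeSym g '' K) p q =
      facetMax K (g.2⁻¹ p.1, p.2 * coordSign g) (g.2⁻¹ q.1, q.2 * coordSign g) := by
  have h : ∀ (r : SignedAxis) (x : Space), ((r.2 : ℤ) : ℝ) * cubeSym g x r.1 =
      (((r.2 * coordSign g : ℤˣ) : ℤ) : ℝ) * x (g.2⁻¹ r.1) := fun r x => by
    simp only [cubeSym, coordSign]
    push_cast
    ring
  unfold facetMax
  congr 1
  ext y
  constructor
  · rintro ⟨_, ⟨⟨x, hx, rfl⟩, hq⟩, rfl⟩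
    exact ⟨x, ⟨hx, by rw [← hq, h]⟩, (h p x).symm⟩
  · rintro ⟨x, ⟨hx, hq⟩, rfl⟩
    exact ⟨_, ⟨⟨x, hx, rfl⟩, by rw [← hq, h]⟩, h p x⟩

/-- Even permutations of three letters preserve the cyclic order, odd ones reverse it. -/
theorem perm_cyclic : ∀ (τ : Equiv.Perm (Fin 3)) (i : Fin 3),
    (Equiv.Perm.sign τ = 1 ∧ τ⁻¹ (i + 1) = τ⁻¹ i + 1 ∧ τ⁻¹ (i - 1) = τ⁻¹ i - 1) ∨
    (Equiv.Perm.sign τ = -1 ∧ τ⁻¹ (i + 1) = τ⁻¹ i - 1 ∧ τ⁻¹ (i - 1) = τ⁻¹ i + 1) := by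
  decide +kernel

theorem axisDiff_cubeSym (K : Set Space) (g : CubeGroup) (p : SignedAxis) :
    axisDiff (cubeSym g '' K) p =
      ((Equiv.Perm.sign g.2 : ℤ) : ℝ) * axisDiff K (g.2⁻¹ p.1, p.2 * coordSign g) := by
  simp only [axisDiff, facetMax_cubeSym, neg_mul]
  rcases perm_cyclic g.2 p.1 with ⟨h1, h2, h3⟩ | ⟨h1, h2, h3⟩ <;> rw [h1, h2, h3] <;> simp

theorem facetMax_neg (K : Set Space) (p q : SignedAxis) :
    facetMax ((fun x : Space => -x) '' K) p q = facetMax K (p.1, -p.2) (q.1, -q.2) := by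
  have h := facetMax_cubeSym K (-1, 1) p q
  have hc : coordSign (-1, 1) = -1 := by simp [coordSign]
  have hs : cubeSym (-1, 1) = fun x : Space => -x := by
    rw [cubeSym_eq_of_neg_one hc]; funext x i; simp
  rw [hs, hc] at h
  simpa using h

theorem axisDiff_neg (K : Set Space) (p : SignedAxis) :
    axisDiff ((fun x : Space => -x) '' K) p = axisDiff K (p.1, -p.2) := by
  simp only [axisDiff, facetMax_neg]

/-- The depth at which the edge `x_j = lo`, `x_i = hi` of the bounding box is cut off. -/
def cutDepth (a : Matrix (Fin 4) (Fin 4) ℝ) (i j : Fin 3) : ℝ :=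
  a j.castSucc i.castSucc - a j.castSucc 3 - a 3 i.castSucc

theorem IsGeneric.cutDepth_pos (h : IsGeneric a) {i j : Fin 3} : 0 < cutDepth a i j := by
  have := h.strict j.castSucc i.castSucc 3 (castSucc_ne_three j) (castSucc_ne_three i).symm
  simp only [cutDepth]; linarith

theorem cubePt_add_one (a : Matrix (Fin 4) (Fin 4) ℝ) (x : Space) (i : Fin 3) :
    cubePt a x i + 1 = 2 / side a i * (x i - a i.castSucc 3) := by
  simp only [cubePt]; ring

theorem one_sub_cubePt (h : IsGeneric a) (x : Space) (i : Fin 3) :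
    1 - cubePt a x i = 2 / side a i * (- a 3 i.castSucc - x i) := by
  have hs := (h.side_pos i).ne'
  simp only [cubePt]
  field_simp
  simp only [side]
  ring

theorem facetMax_cubeBody (h : IsGeneric a) (i j : Fin 3) :
    facetMax (cubeBody a) (i, 1) (j, -1) = 1 - 2 / side a i * cutDepth a i j := by
  have hpos : ∀ k, 0 < 2 / side a k := fun k => div_pos two_pos (h.side_pos k)
  refine IsGreatest.csSup_eq ⟨?_, ?_⟩
  · refine ⟨cubePt a (rowPoint a j.castSucc), ⟨⟨_, h.isKleene.rowPoint_mem _, rfl⟩, ?_⟩, ?_⟩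
    · have := cubePt_add_one a (rowPoint a j.castSucc) j
      simp [rowPoint, ofHom, h.diag] at this ⊢
      linarith
    · have := one_sub_cubePt h (rowPoint a j.castSucc) i
      have e : - a 3 i.castSucc - rowPoint a j.castSucc i = cutDepth a i j := by
        simp [rowPoint, ofHom, cutDepth]; ring
      rw [e] at this
      simp; linarith
  · rintro _ ⟨_, ⟨⟨x, hx, rfl⟩, hj⟩, rfl⟩
    have h1 := cubePt_add_one a x j
    have h2 := one_sub_cubePt h x i
    simp at hj
    rw [(by linarith : cubePt a x j + 1 = 0), zero_eq_mul] at h1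
    have h3 := h1.resolve_left (hpos j).ne'
    have h4 := hx j.castSucc i.castSucc
    simp only [hom_castSucc] at h4
    have h5 : cutDepth a i j ≤ - a 3 i.castSucc - x i := by
      simp only [cutDepth]; linarith
    have := mul_le_mul_of_nonneg_left h5 (hpos i).le
    simp; linarith

/-- The least value of a functional that is nonnegative on the cube and vanishes on an edge. -/
noncomputable def edgeMin (t : ℝ) (i j : Fin 3) (K : Set Space) : ℝ :=
  sInf ((fun x : Space => t * (x j + 1) + (1 - x i)) '' K)

theorem edgeMin_cubeBody (h : IsGeneric a) {t : ℝ} (ht : 0 ≤ t) (i j : Fin 3) :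
    edgeMin t i j (cubeBody a) =
      min (t * (2 / side a j * cutDepth a i j)) (2 / side a i * cutDepth a i j) := by
  have hpos : ∀ k, 0 < 2 / side a k := fun k => div_pos two_pos (h.side_pos k)
  have hval : ∀ x, t * (cubePt a x j + 1) + (1 - cubePt a x i) =
      t * (2 / side a j) * (x j - a j.castSucc 3) + 2 / side a i * (- a 3 i.castSucc - x i) :=
    fun x => by rw [cubePt_add_one a, one_sub_cubePt h]; ring
  refine IsLeast.csInf_eq ⟨?_, ?_⟩
  · rcases min_choice (t * (2 / side a j * cutDepth a i j)) (2 / side a i * cutDepth a i j)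
      with hm | hm <;> rw [hm]
    · refine ⟨_, ⟨_, h.isKleene.colPoint_mem i.castSucc, rfl⟩, ?_⟩
      simp only
      rw [hval]
      simp [colPoint, ofHom, h.diag, cutDepth]
      ring
    · refine ⟨_, ⟨_, h.isKleene.rowPoint_mem j.castSucc, rfl⟩, ?_⟩
      simp only
      rw [hval]
      simp [rowPoint, ofHom, h.diag, cutDepth]
      left; ring
  · rintro _ ⟨_, ⟨x, hx, rfl⟩, rfl⟩
    simp only
    rw [hval]
    have h1 := hx j.castSucc i.castSucc
    have h2 := hx j.castSucc 3
    have h3 := hx 3 i.castSucc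
    simp only [hom_castSucc, hom_three] at h1 h2 h3
    have p0 : 0 ≤ x j - a j.castSucc 3 := by linarith
    have q0 : 0 ≤ - a 3 i.castSucc - x i := by linarith
    have pq : cutDepth a i j ≤ (x j - a j.castSucc 3) + (- a 3 i.castSucc - x i) := by
      simp only [cutDepth]; linarith
    have hA : 0 ≤ t * (2 / side a j) := mul_nonneg ht (hpos j).le
    have hB := (hpos i).le
    rw [← mul_assoc]
    rcases le_total (t * (2 / side a j)) (2 / side a i) with hle | hle
    · refine (min_le_left _ _).trans ((mul_le_mul_of_nonneg_left pq hA).trans ?_)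
      rw [mul_add]
      have := mul_le_mul_of_nonneg_right hle q0
      linarith
    · refine (min_le_right _ _).trans ((mul_le_mul_of_nonneg_left pq hB).trans ?_)
      rw [mul_add]
      have := mul_le_mul_of_nonneg_right hle p0
      linarith

/-- The signed coordinates in the order of the difference tuple: the `m`-th entry compares two
edges of the cube which share the facet in direction `axis m`. -/
def axis : Fin 6 ≃ SignedAxis where
  toFun := ![(2, 1), (0, -1), (1, 1), (2, -1), (0, 1), (1, -1)]
  invFun p := if p.2 = 1 then ![4, 2, 0] p.1 else ![1, 5, 3] p.1
  left_inv := by decide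
  right_inv := by decide

theorem axisDiff_cubeBody_one (h : IsGeneric a) (i : Fin 3) :
    axisDiff (cubeBody a) (i, 1) =
      2 / side a i * (cutDepth a i (i - 1) - cutDepth a i (i + 1)) := by
  simp only [axisDiff, facetMax_cubeBody h]; ring

theorem axisDiff_cubeBody_neg_one (h : IsGeneric a) (i : Fin 3) :
    axisDiff (cubeBody a) (i, -1) =
      2 / side a i * (cutDepth a.transpose i (i - 1) - cutDepth a.transpose i (i + 1)) := by
  have h1 := axisDiff_neg (cubeBody a) (i, 1)
  rw [h.neg_image_cubeBody, axisDiff_cubeBody_one h.transpose] at h1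
  rw [← h1]
  congr 2
  simp only [side, Matrix.transpose_apply]; ring

theorem axisDiff_cubeBody (h : IsGeneric a) (m : Fin 6) :
    axisDiff (cubeBody a) (axis m) = 2 / side a (axis m).1 * sqMinor a m := by
  have e : (-1 : Fin 3) = 2 := rfl
  fin_cases m
  · refine (axisDiff_cubeBody_one h 2).trans (congr_arg _ ?_)
    simp [cutDepth, sqMinor, row₁, row₂, col₁, col₂]; ring
  · refine (axisDiff_cubeBody_neg_one h 0).trans (congr_arg _ ?_)
    simp [e, cutDepth, sqMinor, row₁, row₂, col₁, col₂]; ring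
  · refine (axisDiff_cubeBody_one h 1).trans (congr_arg _ ?_)
    simp [cutDepth, sqMinor, row₁, row₂, col₁, col₂]; ring
  · refine (axisDiff_cubeBody_neg_one h 2).trans (congr_arg _ ?_)
    simp [cutDepth, sqMinor, row₁, row₂, col₁, col₂]; ring
  · refine (axisDiff_cubeBody_one h 0).trans (congr_arg _ ?_)
    simp [e, cutDepth, sqMinor, row₁, row₂, col₁, col₂]; ring
  · refine (axisDiff_cubeBody_neg_one h 1).trans (congr_arg _ ?_)
    simp [cutDepth, sqMinor, row₁, row₂, col₁, col₂]; ring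

/-- The signs of a normalized body are those of the minors of its matrix. -/
theorem signsOf_axisDiff_iff (h : IsGeneric a) {s : SignTuple} :
    SignsOf (fun m => axisDiff (cubeBody a) (axis m)) s ↔ SignsOf (sqMinor a) s := by
  have hpos : ∀ k, 0 < 2 / side a k := fun k => div_pos two_pos (h.side_pos k)
  constructor
  · exact fun hs => hs.congr fun m => ⟨_, inv_pos.2 (hpos (axis m).1), by
      rw [axisDiff_cubeBody h, inv_mul_cancel_left₀ (hpos _).ne']⟩
  · exact fun hs => hs.congr fun m => ⟨_, hpos (axis m).1, axisDiff_cubeBody h m⟩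

/-! ### Continuity of the invariants -/

theorem continuous_sInf_image {E : Type*} [TopologicalSpace E] {φ : E → ℝ} (hφ : Continuous φ) :
    Continuous fun K : NonemptyCompacts E => sInf (φ '' (K : Set E)) := by
  have hmin : ∀ K : NonemptyCompacts E, ∃ x ∈ (K : Set E),
      sInf (φ '' (K : Set E)) = φ x ∧ ∀ y ∈ (K : Set E), φ x ≤ φ y := fun K => by
    obtain ⟨x, hx, he, h⟩ := K.isCompact.exists_sInf_image_eq_and_le K.nonempty hφ.continuousOn
    exact ⟨x, hx, he, h⟩
  rw [OrderTopology.continuous_iff]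
  refine fun c => ⟨?_, ?_⟩
  · convert NonemptyCompacts.isOpen_subsets_of_isOpen (isOpen_lt continuous_const hφ :
      IsOpen {x | c < φ x}) using 1
    ext K
    obtain ⟨x, hx, he, h⟩ := hmin K
    simp only [Set.mem_preimage, Set.mem_Ioi, he]
    exact ⟨fun hc y hy => hc.trans_le (h y hy), fun hs => hs hx⟩
  · convert NonemptyCompacts.isOpen_inter_nonempty_of_isOpen (isOpen_lt hφ continuous_const :
      IsOpen {x | φ x < c}) using 1
    ext K
    obtain ⟨x, hx, he, h⟩ := hmin K
    simp only [Set.mem_preimage, Set.mem_Iio, he]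
    exact ⟨fun hc => ⟨x, hx, hc⟩, fun ⟨y, hy, hc⟩ => (h y hy).trans_lt hc⟩

/-- The normalized bodies of generic matrices. -/
def genericBodies : Set (NonemptyCompacts Space) :=
  {K | ∃ a, IsGeneric a ∧ (K : Set Space) = cubeBody a}

/-- The greatest values on facets are not continuous on all convex bodies, but they are locally
given by the least value of a fixed functional on the normalized bodies. -/
theorem continuousOn_facetMax_one (i j : Fin 3) :
    ContinuousOn (fun K : NonemptyCompacts Space => facetMax (K : Set Space) (i, 1) (j, -1))
      genericBodies := by
  have hcont : ∀ t, Continuous fun K : NonemptyCompacts Space => edgeMin t i j (K : Set Space) :=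
    fun t => continuous_sInf_image (by fun_prop)
  rintro K₀ ⟨a, ha, hK₀⟩
  -- the least value of `t (x_j + 1) + (1 - x_i)` is `min (t u) w`, and equals `w` for large `t`
  have hu : ∀ {b}, IsGeneric b → ∀ k, 0 < 2 / side b k * cutDepth b i j := fun hb k =>
    mul_pos (div_pos two_pos (hb.side_pos k)) hb.cutDepth_pos
  set u₀ := 2 / side a j * cutDepth a i j with hu₀
  set w₀ := 2 / side a i * cutDepth a i j with hw₀
  have hu₀' : 0 < u₀ := hu ha j
  have hw₀' : 0 < w₀ := hu ha i
  set t := 2 * w₀ / u₀ with ht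
  have ht0 : 0 < t := by positivity
  have htu : t * u₀ = 2 * w₀ := by rw [ht]; field_simp
  have hopen : ∀ᶠ K : NonemptyCompacts Space in nhds K₀,
      edgeMin (2 * t) i j (K : Set Space) < 2 * edgeMin t i j (K : Set Space) := by
    refine ((hcont (2 * t)).continuousAt.eventually_lt
      (continuous_const.mul (hcont t)).continuousAt ?_)
    rw [hK₀, edgeMin_cubeBody ha ht0.le, edgeMin_cubeBody ha (by positivity), ← hu₀, ← hw₀,
      min_eq_right (by nlinarith), min_eq_right (by nlinarith)]
    linarith
  have hev : ∀ᶠ K : NonemptyCompacts Space in nhdsWithin K₀ genericBodies,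
      1 - edgeMin (2 * t) i j (K : Set Space) = facetMax (K : Set Space) (i, 1) (j, -1) := by
    filter_upwards [hopen.filter_mono nhdsWithin_le_nhds, self_mem_nhdsWithin] with K hK hKg
    obtain ⟨b, hb, hKb⟩ := hKg
    rw [hKb] at hK ⊢
    rw [edgeMin_cubeBody hb ht0.le, edgeMin_cubeBody hb (by positivity)] at hK
    rw [facetMax_cubeBody hb, edgeMin_cubeBody hb (by positivity), min_eq_right]
    by_contra! hlt
    rw [min_eq_left hlt.le] at hK
    have := min_le_left (t * (2 / side b j * cutDepth b i j)) (2 / side b i * cutDepth b i j)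
    linarith
  refine (((continuous_const.sub (hcont (2 * t))).continuousWithinAt).congr_of_eventuallyEq
    (hev.mono fun K hK => hK.symm) (hev.self_of_nhdsWithin ⟨a, ha, hK₀⟩).symm)

theorem continuousOn_facetMax (i j : Fin 3) (ε : ℤˣ) :
    ContinuousOn (fun K : NonemptyCompacts Space => facetMax (K : Set Space) (i, ε) (j, -ε))
      genericBodies := by
  rcases Int.units_eq_one_or ε with rfl | rfl
  · exact continuousOn_facetMax_one i j
  · have hneg : Continuous fun x : Space => -x := continuous_neg
    have h := (continuousOn_facetMax_one i j).comp
      (hneg.nonemptyCompacts_map.continuousOn (s := genericBodies)) (by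
        rintro K ⟨a, ha, hK⟩
        exact ⟨_, ha.transpose, by rw [NonemptyCompacts.coe_map, hK, ha.neg_image_cubeBody]⟩)
    refine h.congr fun K _ => ?_
    simp only [Function.comp, NonemptyCompacts.coe_map]
    rw [facetMax_neg]

theorem continuousOn_axisDiff (p : SignedAxis) :
    ContinuousOn (fun K : NonemptyCompacts Space => axisDiff (K : Set Space) p) genericBodies :=
  (continuousOn_facetMax p.1 (p.1 + 1) p.2).sub (continuousOn_facetMax p.1 (p.1 - 1) p.2)

/-- The signs of a body with respect to the signed axes. -/
def BodySigns (K : NonemptyCompacts Space) (s : SignTuple) : Prop :=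
  SignsOf (fun m => axisDiff (K : Set Space) (axis m)) s

theorem exists_bodySigns {K : NonemptyCompacts Space} (hK : K ∈ genericBodies) :
    ∃ s, BodySigns K s := by
  obtain ⟨a, ha, hKa⟩ := hK
  obtain ⟨s, hs⟩ := ha.exists_signsOf
  exact ⟨s, by rw [BodySigns, hKa]; exact (signsOf_axisDiff_iff ha).2 hs⟩

theorem BodySigns.unique {K : NonemptyCompacts Space} {s t : SignTuple} (hs : BodySigns K s)
    (ht : BodySigns K t) : s = t := SignsOf.unique hs ht fun _ => Iff.rfl

/-- The signs do not change along paths of normalized bodies. -/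
theorem BodySigns.eq_of_joinedIn {K L : NonemptyCompacts Space} {s t : SignTuple}
    (hs : BodySigns K s) (ht : BodySigns L t) (h : JoinedIn genericBodies K L) : s = t := by
  obtain ⟨γ, hγ⟩ := h
  refine SignsOf.unique hs ht fun m => ?_
  have hc : Continuous fun r => axisDiff (γ r : Set Space) (axis m) :=
    (continuousOn_axisDiff (axis m)).comp_continuous γ.continuous hγ
  have h0 : ∀ r, axisDiff (γ r : Set Space) (axis m) ≠ 0 := fun r => by
    obtain ⟨u, hu⟩ := exists_bodySigns (hγ r)
    exact hu.ne_zero m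
  have key : ∀ r r', 0 < axisDiff (γ r : Set Space) (axis m) →
      0 < axisDiff (γ r' : Set Space) (axis m) := fun r r' hr => by
    by_contra! hr'
    obtain ⟨z, hz⟩ := mem_range_of_exists_le_of_exists_ge hc ⟨r', hr'⟩ ⟨r, hr.le⟩
    exact h0 z hz
  have k0 := key 0 1
  have k1 := key 1 0
  simp only [γ.source, γ.target] at k0 k1
  exact ⟨k0, k1⟩

/-! ### Paths of alcoved polyhedra -/

variable {b : Matrix (Fin 4) (Fin 4) ℝ}

/-- The points `x ∈ ℝ³` obtained from the columns of `a` by the tropical linear combination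
with coefficients `w`. -/
noncomputable def tropicalMap (a : Matrix (Fin 4) (Fin 4) ℝ) (w : Space) : Space :=
  ofHom fun i => ⨆ k, (hom w k + a i k)

theorem IsKleene.tropicalMap_mem (ha : IsKleene a) (w : Space) : tropicalMap a w ∈ body a :=
  fun i j => by
    have := ha.le_iSup_sub_iSup (hom w) i j
    simp only [tropicalMap, hom_ofHom]; linarith

theorem IsKleene.tropicalMap_eq (ha : IsKleene a) {x : Space} (hx : x ∈ body a) :
    tropicalMap a x = x := by
  simp only [tropicalMap, ha.iSup_eq_of_mem_body hx, ofHom_hom]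

theorem continuous_tropicalMap :
    Continuous fun p : Matrix (Fin 4) (Fin 4) ℝ × Space => tropicalMap p.1 p.2 := by
  have h : ∀ i, Continuous fun p : Matrix (Fin 4) (Fin 4) ℝ × Space =>
      ⨆ k, (hom p.2 k + p.1 i k) := fun i => by
    simp only [← Finset.sup'_univ_eq_ciSup]
    refine Continuous.finset_sup'_apply _ fun k _ => ?_
    exact ((continuous_hom k).comp continuous_snd).add
      ((continuous_apply_apply i k).comp continuous_fst)
  refine continuous_pi fun i => ?_
  simp only [tropicalMap, ofHom]
  exact (h _).sub (h _)

/-- The segment between two matrices. -/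
def segmentMatrix (a b : Matrix (Fin 4) (Fin 4) ℝ) (t : ℝ) : Matrix (Fin 4) (Fin 4) ℝ :=
  fun i j => (1 - t) * a i j + t * b i j

theorem sqMinor_segmentMatrix (t : ℝ) (m : Fin 6) :
    sqMinor (segmentMatrix a b t) m = (1 - t) * sqMinor a m + t * sqMinor b m := by
  simp only [sqMinor, segmentMatrix]; ring

theorem add_pos_of_unitInterval {t x y : ℝ} (h0 : 0 ≤ t) (h1 : t ≤ 1) (hx : 0 < x) (hy : 0 < y) :
    0 < (1 - t) * x + t * y := by
  rcases h0.eq_or_lt with rfl | h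
  · simpa using hx
  · have := mul_pos h hy
    have := mul_nonneg (sub_nonneg.2 h1) hx.le
    linarith

theorem signsOf_segmentMatrix {s : SignTuple} (ha : SignsOf (sqMinor a) s)
    (hb : SignsOf (sqMinor b) s) {t : ℝ} (h0 : 0 ≤ t) (h1 : t ≤ 1) :
    SignsOf (sqMinor (segmentMatrix a b t)) s := fun m => by
  rw [sqMinor_segmentMatrix]
  have := add_pos_of_unitInterval h0 h1 (ha m) (hb m)
  linarith

/-- The generic matrices with given signs form a convex set. -/
theorem isGeneric_segmentMatrix (ha : IsGeneric a) (hb : IsGeneric b) {s : SignTuple}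
    (hsa : SignsOf (sqMinor a) s) (hsb : SignsOf (sqMinor b) s) {t : ℝ} (h0 : 0 ≤ t) (h1 : t ≤ 1) :
    IsGeneric (segmentMatrix a b t) := by
  refine isGeneric_of_minor (fun i => ?_) (fun i j k hik hkj => ?_)
    (signsOf_segmentMatrix hsa hsb h0 h1).ne_zero
  · simp [segmentMatrix, ha.diag, hb.diag]
  · have := add_pos_of_unitInterval h0 h1 (sub_pos.2 (ha.strict i j k hik hkj))
      (sub_pos.2 (hb.strict i j k hik hkj))
    simp only [segmentMatrix]; linarith

/-- Normalized bodies with the same signs are joined by the normalized bodies of the segment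
between their matrices. -/
theorem joinedIn_of_signs {K L : NonemptyCompacts Space} {𝓕 : Set (NonemptyCompacts Space)}
    {s : SignTuple} (ha : IsGeneric a) (hb : IsGeneric b)
    (hsa : SignsOf (sqMinor a) s) (hsb : SignsOf (sqMinor b) s)
    (hK : (K : Set Space) = cubeBody a) (hL : (L : Set Space) = cubeBody b)
    (h𝓕 : ∀ t ∈ Set.Icc (0 : ℝ) 1, ∀ M : NonemptyCompacts Space,
      (M : Set Space) = cubeBody (segmentMatrix a b t) → M ∈ 𝓕) : JoinedIn 𝓕 K L := by
  have hgen : ∀ t : unitInterval, IsGeneric (segmentMatrix a b t) := fun t =>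
    isGeneric_segmentMatrix ha hb hsa hsb t.2.1 t.2.2
  set R : ℝ := ∑ i, ∑ j, (|a i j| + |b i j|) with hR
  have hent : ∀ i j, |a i j| + |b i j| ≤ R := fun i j =>
    (Finset.single_le_sum (f := fun j => |a i j| + |b i j|) (fun _ _ => by positivity)
      (Finset.mem_univ j)).trans
    (Finset.single_le_sum (f := fun i => ∑ j, (|a i j| + |b i j|)) (fun _ _ => by positivity)
      (Finset.mem_univ i))
  have hR0 : 0 ≤ R := (by positivity : 0 ≤ |a 0 0| + |b 0 0|).trans (hent 0 0)
  let box : NonemptyCompacts Space :=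
    ⟨⟨Set.Icc (fun _ => -R) (fun _ => R), isCompact_Icc⟩, ⟨0, by simp [Pi.le_def, hR0]⟩⟩
  have hbox : ∀ t : unitInterval, body (segmentMatrix a b t) ⊆ (box : Set Space) := by
    intro t x hx
    have hle : ∀ i j, -R ≤ segmentMatrix a b t i j := fun i j => by
      have h1 := hent i j
      have h2 := neg_abs_le (a i j)
      have h3 := neg_abs_le (b i j)
      have h4 := t.2.1
      have h5 := t.2.2
      have h6 := abs_nonneg (a i j)
      have h7 := abs_nonneg (b i j)
      simp only [segmentMatrix]
      nlinarith
    refine ⟨fun i => ?_, fun i => ?_⟩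
    · have h1 := hx i.castSucc 3
      have h2 := hle i.castSucc 3
      simp only [hom_castSucc, hom_three] at h1
      linarith
    · have h1 := hx 3 i.castSucc
      have h2 := hle 3 i.castSucc
      simp only [hom_castSucc, hom_three] at h1
      linarith
  have hseg : Continuous fun t : unitInterval => segmentMatrix a b t := by
    refine continuous_pi fun i => continuous_pi fun j => ?_
    simp only [segmentMatrix]
    fun_prop
  let g : unitInterval → Space → Space := fun t w =>
    cubePt (segmentMatrix a b t) (tropicalMap (segmentMatrix a b t) w)
  have hg : Continuous g.uncurry := by
    have h1 : Continuous fun p : unitInterval × Space =>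
        tropicalMap (segmentMatrix a b p.1) p.2 :=
      continuous_tropicalMap.comp ((hseg.comp continuous_fst).prodMk continuous_snd)
    have hent : ∀ i j, Continuous fun p : unitInterval × Space => segmentMatrix a b p.1 i j :=
      fun i j => (continuous_apply_apply i j).comp (hseg.comp continuous_fst)
    refine continuous_pi fun i => ?_
    simp only [g, Function.uncurry_def, cubePt]
    refine Continuous.sub (Continuous.div ?_ ?_ fun p => ((hgen p.1).side_pos i).ne')
      continuous_const
    · exact continuous_const.mul (((continuous_apply i).comp h1).sub (hent _ _))
    · simp only [side]
      exact (hent _ _).neg.sub (hent _ _)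
  have hcoe : ∀ t : unitInterval,
      ((box.map (g t) (by fun_prop) : NonemptyCompacts Space) : Set Space) =
        cubeBody (segmentMatrix a b t) := by
    intro t
    rw [NonemptyCompacts.coe_map]
    ext y
    constructor
    · rintro ⟨w, -, rfl⟩
      exact ⟨_, (hgen t).isKleene.tropicalMap_mem w, rfl⟩
    · rintro ⟨x, hx, rfl⟩
      exact ⟨x, hbox t hx, by simp only [g, (hgen t).isKleene.tropicalMap_eq hx]⟩
  have h0 : segmentMatrix a b ((0 : unitInterval) : ℝ) = a := by
    ext i j; simp [segmentMatrix]
  have h1 : segmentMatrix a b ((1 : unitInterval) : ℝ) = b := by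
    ext i j; simp [segmentMatrix]
  refine ⟨⟨⟨fun t => box.map (g t) (by fun_prop), ?_⟩, ?_, ?_⟩, ?_⟩
  · exact Continuous.nonemptyCompacts_map' continuous_const hg
  · exact SetLike.coe_injective ((hcoe 0).trans (by rw [h0, hK]))
  · exact SetLike.coe_injective ((hcoe 1).trans (by rw [h1, hL]))
  · exact fun t => h𝓕 t t.2 _ (hcoe t)

/-! ### The group of sign symmetries and its orbits -/

/-- The action of the cube symmetries on the signed axes, as signed permutations of six letters. -/
def signHom : CubeGroup →* ℤˣ × Equiv.Perm (Fin 6) where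
  toFun g := (Equiv.Perm.sign g.2,
    (axis.trans (Equiv.prodCongr g.2 (Equiv.mulLeft g.1))).trans axis.symm)
  map_one' := by
    ext m <;> simp
  map_mul' g h := by
    refine Prod.ext (by simp) (Equiv.ext fun m => ?_)
    simp [mul_assoc]
    rfl

/-- The action of the cube symmetries on sign tuples through `signHom`. -/
def signAct (g : CubeGroup) (s : Fin 6 → ℤˣ) : Fin 6 → ℤˣ := fun m =>
  Equiv.Perm.sign g.2 * s (axis.symm (g.2⁻¹ (axis m).1, (axis m).2 * g.1))

theorem coe_signHom_smul (g : CubeGroup) (s : SignTuple) :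
    (signHom g • s).1 = signAct g s.1 := by
  have key : ∀ m, (signHom g).2⁻¹ m = axis.symm (g.2⁻¹ (axis m).1, (axis m).2 * g.1) := fun m => by
    rw [Equiv.Perm.inv_eq_iff_eq]
    have h : g.1 * g.1 = 1 := Int.units_mul_self _
    change m = axis.symm ((Equiv.prodCongr g.2 (Equiv.mulLeft g.1)) (axis _))
    simp [mul_comm (axis m).2, ← mul_assoc, h]
  exact funext fun m => congr_arg (fun n => Equiv.Perm.sign g.2 * s.1 n) (key m)

theorem signHom_neg_one : signHom (-1, 1) = genAntipodal := by decide +kernel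
theorem signHom_swap_zero_one : signHom (1, Equiv.swap 0 1) = gen12 := by decide +kernel
theorem signHom_swap_zero_two : signHom (1, Equiv.swap 0 2) = gen13 := by decide +kernel
theorem signHom_swap_one_two : signHom (1, Equiv.swap 1 2) = gen23 := by decide +kernel

theorem signHom_injective : Function.Injective signHom := by
  rw [injective_iff_map_eq_one]
  decide +kernel

theorem cubeGroup_generated : ∀ g : CubeGroup,
    ∃ e : Bool, ∃ x ∈ ({1, Equiv.swap 0 1, Equiv.swap 0 2, Equiv.swap 1 2} :
      Finset (Equiv.Perm (Fin 3))),
    ∃ y ∈ ({1, Equiv.swap 0 1, Equiv.swap 0 2, Equiv.swap 1 2} : Finset (Equiv.Perm (Fin 3))),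
      g = (cond e 1 (-1, 1)) * (1, x) * (1, y) := by
  decide +kernel

theorem range_signHom : signHom.range = signGroup := by
  have h0 : signHom (-1, 1) ∈ signGroup :=
    Subgroup.subset_closure (by simp [signHom_neg_one])
  have h1 : signHom (1, Equiv.swap 0 1) ∈ signGroup :=
    Subgroup.subset_closure (by simp [signHom_swap_zero_one])
  have h2 : signHom (1, Equiv.swap 0 2) ∈ signGroup :=
    Subgroup.subset_closure (by simp [signHom_swap_zero_two])
  have h3 : signHom (1, Equiv.swap 1 2) ∈ signGroup :=
    Subgroup.subset_closure (by simp [signHom_swap_one_two])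
  have hx : ∀ x ∈ ({1, Equiv.swap 0 1, Equiv.swap 0 2, Equiv.swap 1 2} :
      Finset (Equiv.Perm (Fin 3))), signHom (1, x) ∈ signGroup := by
    simp only [Finset.mem_insert, Finset.mem_singleton, forall_eq_or_imp, forall_eq]
    refine ⟨?_, h1, h2, h3⟩
    rw [← Prod.one_eq_mk, map_one]
    exact one_mem _
  apply le_antisymm
  · rintro _ ⟨g, rfl⟩
    obtain ⟨e, x, hx', y, hy', rfl⟩ := cubeGroup_generated g
    rw [map_mul, map_mul]
    refine mul_mem (mul_mem ?_ (hx x hx')) (hx y hy')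
    cases e
    · exact h0
    · rw [cond_true, map_one]; exact one_mem _
  · rw [signGroup, Subgroup.closure_le]
    rintro _ (rfl | rfl | rfl | rfl)
    exacts [⟨_, signHom_neg_one⟩, ⟨_, signHom_swap_zero_one⟩, ⟨_, signHom_swap_zero_two⟩,
      ⟨_, signHom_swap_one_two⟩]

/-- The isomorphism from the cube symmetries onto the group of sign symmetries. -/
noncomputable def signEquiv : CubeGroup ≃* signGroup :=
  (MonoidHom.ofInjective signHom_injective).trans (MulEquiv.subgroupCongr range_signHom)

@[simp] theorem coe_signEquiv (g : CubeGroup) :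
    (signEquiv g : ℤˣ × Equiv.Perm (Fin 6)) = signHom g := rfl

theorem orbitOf_eq_iff {s t : SignTuple} :
    orbitOf s = orbitOf t ↔ ∃ g : CubeGroup, signHom g • t = s := by
  rw [orbitOf, orbitOf, Quotient.eq, MulAction.orbitRel_apply, MulAction.mem_orbit_iff]
  constructor
  · rintro ⟨⟨_, h⟩, rfl⟩
    rw [← range_signHom] at h
    obtain ⟨g, rfl⟩ := h
    exact ⟨g, rfl⟩
  · rintro ⟨g, rfl⟩
    exact ⟨signEquiv g, rfl⟩

theorem card_signTuple : Nat.card SignTuple = 62 := by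
  have h : Fintype.card {s : Fin 6 → ℤˣ // ¬ ∀ i j, s i = s j} = 62 := by decide +kernel
  rw [← h, ← Nat.card_eq_fintype_card]
  rfl

/-- Representatives for the orbits of sign tuples. -/
def orbitRep : Fin 8 → Fin 6 → ℤˣ :=
  ![![1, 1, 1, 1, 1, -1], ![1, 1, 1, 1, -1, -1], ![1, 1, 1, -1, 1, -1], ![1, 1, 1, -1, -1, -1],
    ![1, 1, -1, 1, 1, -1], ![1, 1, -1, 1, -1, -1], ![1, 1, -1, -1, 1, -1], ![1, -1, 1, -1, 1, -1]]

theorem orbitRep_nonconst : ∀ r, ¬ ∀ i j, orbitRep r i = orbitRep r j := by decide +kernel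

theorem exists_signAct_orbitRep : ∀ s : Fin 6 → ℤˣ, (¬ ∀ i j, s i = s j) →
    ∃ r g, signAct g (orbitRep r) = s := by decide +kernel

theorem eq_of_signAct_orbitRep : ∀ r r' g, signAct g (orbitRep r') = orbitRep r → r = r' := by
  decide +kernel

theorem card_signOrbits : Nat.card SignOrbits = 8 := by
  have hb : Function.Bijective fun r : Fin 8 => orbitOf ⟨orbitRep r, orbitRep_nonconst r⟩ := by
    constructor
    · intro r r' h
      obtain ⟨g, hg⟩ := orbitOf_eq_iff.1 h
      exact eq_of_signAct_orbitRep r r' g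
        ((coe_signHom_smul g _).symm.trans (congr_arg Subtype.val hg))
    · intro o
      obtain ⟨s, rfl⟩ := Quotient.exists_rep o
      obtain ⟨r, g, hg⟩ := exists_signAct_orbitRep s.1 s.2
      exact ⟨r, (orbitOf_eq_iff.2 ⟨g, Subtype.ext ((coe_signHom_smul g _).trans hg)⟩).symm⟩
  rw [← Nat.card_eq_of_bijective _ hb, Nat.card_eq_fintype_card, Fintype.card_fin]

/-! ### Quasi-Euclidean classes and orbits of sign tuples -/

theorem BodySigns.cubeSym {K L : NonemptyCompacts Space} {s : SignTuple} (hs : BodySigns K s)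
    {g : CubeGroup} (hL : (L : Set Space) = cubeSym g '' (K : Set Space)) :
    BodySigns L (signHom (coordSign g, g.2) • s) := by
  intro m
  have h := hs (axis.symm (g.2⁻¹ (axis m).1, (axis m).2 * coordSign g))
  simp only [Equiv.apply_symm_apply] at h
  have he := congr_fun (coe_signHom_smul (coordSign g, g.2) s) m
  simp only [hL, axisDiff_cubeSym, he]
  refine h.trans_eq ?_
  rcases Int.units_eq_one_or (Equiv.Perm.sign g.2) with he | he <;> simp [signAct, he]

/-- A class of generic matrices that is stable under the symmetries of the cube, convex as far as
genericity permits, and rich enough to realize all signs. -/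
structure IsAdmissible (𝓒 : Set (Matrix (Fin 4) (Fin 4) ℝ)) : Prop where
  isGeneric : ∀ a ∈ 𝓒, IsGeneric a
  transpose_mem : ∀ a ∈ 𝓒, a.transpose ∈ 𝓒
  submatrix_mem : ∀ a ∈ 𝓒, ∀ τ, a.submatrix (extend τ) (extend τ) ∈ 𝓒
  segmentMatrix_mem : ∀ a ∈ 𝓒, ∀ b ∈ 𝓒, ∀ t, IsGeneric (segmentMatrix a b t) →
    segmentMatrix a b t ∈ 𝓒
  cantMatrix_mem : ∀ z, IsGeneric (cantMatrix z) → cantMatrix z ∈ 𝓒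

/-- The normalized bodies of a class of matrices. -/
def bodies (𝓒 : Set (Matrix (Fin 4) (Fin 4) ℝ)) : Set (NonemptyCompacts Space) :=
  {K | ∃ a ∈ 𝓒, (K : Set Space) = cubeBody a}

variable {𝓒 : Set (Matrix (Fin 4) (Fin 4) ℝ)}

theorem IsAdmissible.bodies_subset (h : IsAdmissible 𝓒) : bodies 𝓒 ⊆ genericBodies := by
  rintro K ⟨a, ha, hK⟩
  exact ⟨a, h.isGeneric a ha, hK⟩

theorem IsAdmissible.exists_cubeSym (h : IsAdmissible 𝓒) {K : NonemptyCompacts Space}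
    (hK : K ∈ bodies 𝓒) (g : CubeGroup) :
    ∃ L ∈ bodies 𝓒, (L : Set Space) = cubeSym g '' (K : Set Space) := by
  obtain ⟨a, ha, hKa⟩ := hK
  have hc : Continuous (cubeSym g) := by
    unfold cubeSym
    fun_prop
  have ha' := h.submatrix_mem a ha g.2⁻¹
  refine ⟨K.map (cubeSym g) hc, ?_, NonemptyCompacts.coe_map _ _⟩
  rcases Int.units_eq_one_or (coordSign g) with hg | hg
  · refine ⟨_, ha', ?_⟩
    rw [NonemptyCompacts.coe_map, hKa, cubeSym_eq_of_one hg, comp_perm_image_cubeBody]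
  · refine ⟨_, h.transpose_mem _ ha', ?_⟩
    rw [NonemptyCompacts.coe_map, hKa, cubeSym_eq_of_neg_one hg, Set.image_comp,
      comp_perm_image_cubeBody, (h.isGeneric _ ha').neg_image_cubeBody]

theorem IsAdmissible.joinedIn (h : IsAdmissible 𝓒) {K L : NonemptyCompacts Space} {s : SignTuple}
    (hK : K ∈ bodies 𝓒) (hL : L ∈ bodies 𝓒) (hKs : BodySigns K s) (hLs : BodySigns L s) :
    JoinedIn (bodies 𝓒) K L := by
  obtain ⟨a, ha, hKa⟩ := hK
  obtain ⟨b, hb, hLb⟩ := hL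
  have ga := h.isGeneric a ha
  have gb := h.isGeneric b hb
  rw [BodySigns, hKa, signsOf_axisDiff_iff ga] at hKs
  rw [BodySigns, hLb, signsOf_axisDiff_iff gb] at hLs
  exact joinedIn_of_signs ga gb hKs hLs hKa hLb fun t ht M hM =>
    ⟨_, h.segmentMatrix_mem a ha b hb t (isGeneric_segmentMatrix ga gb hKs hLs ht.1 ht.2), hM⟩

theorem IsAdmissible.exists_bodySigns (h : IsAdmissible 𝓒) (s : SignTuple) :
    ∃ K ∈ bodies 𝓒, BodySigns K s := by
  obtain ⟨z, hz, hs⟩ := exists_cantMatrix_signsOf s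
  have hc : Continuous (cubePt (cantMatrix z)) := by
    unfold cubePt
    fun_prop
  refine ⟨hz.isKleene.toNonemptyCompacts.map _ hc, ⟨_, h.cantMatrix_mem z hz, ?_⟩, ?_⟩
  · rw [NonemptyCompacts.coe_map]; rfl
  · rw [BodySigns, NonemptyCompacts.coe_map]
    exact (signsOf_axisDiff_iff hz).2 hs

theorem IsAdmissible.cubeEquiv_iff (h : IsAdmissible 𝓒) {𝓕 : Set (NonemptyCompacts Space)}
    (h𝓕 : 𝓕 = bodies 𝓒) (K L : 𝓕) {s t : SignTuple} (hs : BodySigns K s)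
    (ht : BodySigns L t) : cubeEquiv 𝓕 K L ↔ orbitOf s = orbitOf t := by
  subst h𝓕
  constructor
  · intro hKL
    change Relation.EqvGen _ K L at hKL
    induction hKL generalizing s t with
    | rel K L hr =>
      rcases hr with ⟨g, hg⟩ | hj
      · exact (orbitOf_eq_iff.2 ⟨_, (hs.cubeSym hg).unique ht⟩).symm
      · rw [hs.eq_of_joinedIn ht (hj.mono h.bodies_subset)]
    | refl K => rw [hs.unique ht]
    | symm K L _ ih => exact (ih ht hs).symm
    | trans K M L _ _ ih₁ ih₂ =>
      obtain ⟨u, hu⟩ := Alcoved.exists_bodySigns (h.bodies_subset M.2)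
      exact (ih₁ hs hu).trans (ih₂ hu ht)
  · intro hst
    obtain ⟨g, rfl⟩ := orbitOf_eq_iff.1 hst
    obtain ⟨M, hM, hML⟩ := h.exists_cubeSym L.2 (g.1 * Equiv.Perm.sign g.2, g.2)
    have hMs := ht.cubeSym hML
    have hg : (coordSign (g.1 * Equiv.Perm.sign g.2, g.2), g.2) = g := by
      simp [coordSign, mul_assoc]
    rw [hg] at hMs
    exact (Relation.EqvGen.rel K ⟨M, hM⟩ (Or.inr (h.joinedIn K.2 hM hs hMs))).trans _ _ _
      ((Relation.EqvGen.rel L ⟨M, hM⟩ (Or.inl ⟨_, hML⟩)).symm _ _)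

theorem exists_quotient_equiv {X Y : Type*} (r : Setoid X) (φ : X → Y)
    (hφ : ∀ x y, r x y ↔ φ x = φ y) (hsurj : Function.Surjective φ) :
    ∃ e : Quotient r ≃ Y, ∀ x, e (Quotient.mk _ x) = φ x := by
  refine ⟨Equiv.ofBijective (Quotient.lift φ fun x y h => (hφ x y).1 h) ⟨?_, ?_⟩, fun x => rfl⟩
  · rintro ⟨x⟩ ⟨y⟩ h
    exact Quotient.sound ((hφ x y).2 h)
  · intro y
    obtain ⟨x, rfl⟩ := hsurj y
    exact ⟨Quotient.mk _ x, rfl⟩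

/-- If the members of `X` are parametrized onto an admissible family of normalized bodies, their
classes correspond to the orbits of sign tuples. -/
theorem IsAdmissible.exists_equiv (h : IsAdmissible 𝓒) {𝓕 : Set (NonemptyCompacts Space)}
    (h𝓕 : 𝓕 = bodies 𝓒) {X : Type*} (r : Setoid X) (f : X → 𝓕) (hf : Function.Surjective f)
    (hr : ∀ x y, r x y ↔ cubeEquiv 𝓕 (f x) (f y)) :
    ∃ e : Quotient r ≃ SignOrbits, ∀ x s,
      BodySigns (f x : NonemptyCompacts Space) s → e (Quotient.mk _ x) = orbitOf s := by
  have hsig : ∀ x, ∃ s, BodySigns (f x : NonemptyCompacts Space) s := fun x =>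
    Alcoved.exists_bodySigns (h.bodies_subset (h𝓕 ▸ (f x).2))
  choose σ hσ using hsig
  obtain ⟨e, he⟩ := exists_quotient_equiv r (fun x => orbitOf (σ x))
    (fun x y => (hr x y).trans (h.cubeEquiv_iff h𝓕 _ _ (hσ x) (hσ y))) (fun o => by
      obtain ⟨s, rfl⟩ := Quotient.exists_rep o
      obtain ⟨K, hK, hs⟩ := h.exists_bodySigns s
      obtain ⟨x, hx⟩ := hf ⟨K, h𝓕 ▸ hK⟩
      refine ⟨x, congr_arg orbitOf ((hσ x).unique ?_)⟩
      rw [hx]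
      exact hs)
  exact ⟨e, fun x s hs => by rw [he, (hσ x).unique hs]⟩

/-! ### The two families of the theorem -/

theorem isAdmissible_isGeneric : IsAdmissible {a | IsGeneric a} where
  isGeneric _ h := h
  transpose_mem _ h := IsGeneric.transpose h
  submatrix_mem _ h τ := IsGeneric.submatrix h (extend_injective τ)
  segmentMatrix_mem _ _ _ _ _ h := h
  cantMatrix_mem _ h := h

/-- The generic matrices of polyhedra with bounding box the cube. -/
def cubeMatrices : Set (Matrix (Fin 4) (Fin 4) ℝ) :=
  {a | IsGeneric a ∧ ∀ i : Fin 3, a i.castSucc 3 = -1 ∧ a 3 i.castSucc = -1}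

theorem isAdmissible_cubeMatrices : IsAdmissible cubeMatrices where
  isGeneric _ h := h.1
  transpose_mem _ h := ⟨h.1.transpose, fun i => (h.2 i).symm⟩
  submatrix_mem _ h τ := ⟨h.1.submatrix (extend_injective τ), fun i => by
    simpa using h.2 (τ i)⟩
  segmentMatrix_mem a ha b hb t h := ⟨h, fun i => by
    simp only [segmentMatrix, (ha.2 i).1, (ha.2 i).2, (hb.2 i).1, (hb.2 i).2]
    constructor <;> ring⟩
  cantMatrix_mem z h := ⟨h, fun i => by fin_cases i <;> simp [cantMatrix]⟩

theorem normalizedFamily_eq : normalizedFamily = bodies {a | IsGeneric a} := by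
  ext K
  constructor
  · rintro ⟨P, hP, rfl⟩
    obtain ⟨a, ha, hPa⟩ := mem_maximalAlcoved_iff.1 hP
    exact ⟨a, ha, coe_toCube ha.isKleene hPa⟩
  · rintro ⟨a, ha, hK⟩
    replace ha : IsGeneric a := ha
    refine ⟨ha.isKleene.toNonemptyCompacts, mem_maximalAlcoved_iff.2 ⟨a, ha, rfl⟩, ?_⟩
    exact SetLike.coe_injective ((coe_toCube ha.isKleene rfl).trans hK.symm)

theorem cubeBody_eq_of_mem_cubeMatrices (ha : a ∈ cubeMatrices) : cubeBody a = body a := by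
  have : cubePt a = id := by
    funext x i
    simp only [cubePt, side, (ha.2 i).1, (ha.2 i).2, id]
    ring
  rw [cubeBody, this, Set.image_id]

theorem maximalInCube_eq : maximalInCube = bodies cubeMatrices := by
  ext K
  constructor
  · rintro ⟨hK, hbox⟩
    obtain ⟨a, ha, hKa⟩ := mem_maximalAlcoved_iff.1 hK
    have hmem : a ∈ cubeMatrices := ⟨ha, fun i => by
      have := hbox i
      rw [lo_eq ha.isKleene hKa, hi_eq ha.isKleene hKa] at this
      exact ⟨this.1, by linarith⟩⟩
    exact ⟨a, hmem, hKa.trans (cubeBody_eq_of_mem_cubeMatrices hmem).symm⟩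
  · rintro ⟨a, ha, hKa⟩
    rw [cubeBody_eq_of_mem_cubeMatrices ha] at hKa
    refine ⟨mem_maximalAlcoved_iff.2 ⟨a, ha.1, hKa⟩, fun i => ?_⟩
    rw [lo_eq ha.1.isKleene hKa, hi_eq ha.1.isKleene hKa, (ha.2 i).1, (ha.2 i).2]
    simp

theorem toCube_eq_self {P : NonemptyCompacts Space} (hP : P ∈ maximalInCube) : toCube P = P := by
  rw [maximalInCube_eq] at hP
  obtain ⟨a, ha, hPa⟩ := hP
  have hPa' := hPa.trans (cubeBody_eq_of_mem_cubeMatrices ha)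
  exact SetLike.coe_injective ((coe_toCube ha.1.isKleene hPa').trans hPa.symm)

/-- The signs of the difference tuple are those of the normalized body. -/
theorem bodySigns_toCube {P : NonemptyCompacts Space} (hP : P ∈ maximalAlcoved)
    {A : Matrix (Fin 4) (Fin 4) ℝ} {s : SignTuple} (hA : Represents A P) (hs : HasSigns A s) :
    BodySigns (toCube P) s := by
  obtain ⟨a, ha, hPa⟩ := mem_maximalAlcoved_iff.1 hP
  rw [BodySigns, coe_toCube ha.isKleene hPa, signsOf_axisDiff_iff ha,
    ← hA.difference_eq ha.isKleene hPa]
  exact hs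

theorem exists_equiv_quasiEuclidean : ∃ e : Quotient quasiEuclidean ≃ SignOrbits,
    ∀ (P : maximalAlcoved) (A : Matrix (Fin 4) (Fin 4) ℝ) (s : SignTuple),
      Represents A P → HasSigns A s → e (Quotient.mk _ P) = orbitOf s := by
  obtain ⟨e, he⟩ := isAdmissible_isGeneric.exists_equiv normalizedFamily_eq quasiEuclidean
    (fun P : maximalAlcoved => ⟨toCube P, Set.mem_image_of_mem toCube P.2⟩)
    (by rintro ⟨_, P, hP, rfl⟩; exact ⟨⟨P, hP⟩, rfl⟩) fun _ _ => Iff.rfl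
  exact ⟨e, fun P A s hA hs => he P s (bodySigns_toCube P.2 hA hs)⟩

theorem exists_equiv_maximalInCube : ∃ e : Quotient (cubeEquiv maximalInCube) ≃ SignOrbits,
    ∀ (P : maximalInCube) (A : Matrix (Fin 4) (Fin 4) ℝ) (s : SignTuple),
      Represents A P → HasSigns A s → e (Quotient.mk _ P) = orbitOf s := by
  obtain ⟨e, he⟩ := isAdmissible_cubeMatrices.exists_equiv maximalInCube_eq
    (cubeEquiv maximalInCube) id Function.surjective_id fun _ _ => Iff.rfl
  refine ⟨e, fun P A s hA hs => he P s ?_⟩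
  have := bodySigns_toCube P.2.1 hA hs
  rwa [toCube_eq_self P.2] at this

end Alcoved

theorem theorem1 :
    -- the maximal alcoved polyhedra are simple dodecahedra with f-vector (20, 30, 12)
    IsGreatest (fVec '' {P | IsAlcoved P}) ![20, 30, 12] ∧
    (∀ P ∈ maximalAlcoved, fVec P = ![20, 30, 12] ∧ IsSimple P) ∧
    -- each one has a unique visualized idempotent matrix; its difference tuple has
    -- nonzero entries that do not all have the same sign
    (∀ P ∈ maximalAlcoved, ∃! A, Represents A P) ∧
    (∀ P ∈ maximalAlcoved, ∀ A, Represents A P → ∃ s : SignTuple, HasSigns A s) ∧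
    -- G₃ is a copy of ℤ₂ × Σ₃, and it has eight orbits on the 62 non-constant sign tuples
    (∃ Θ : CubeGroup ≃* signGroup,
      (Θ (-1, 1) : ℤˣ × Equiv.Perm (Fin 6)) = genAntipodal ∧
      (Θ (1, Equiv.swap 0 1) : ℤˣ × Equiv.Perm (Fin 6)) = gen12 ∧
      (Θ (1, Equiv.swap 0 2) : ℤˣ × Equiv.Perm (Fin 6)) = gen13 ∧
      (Θ (1, Equiv.swap 1 2) : ℤˣ × Equiv.Perm (Fin 6)) = gen23) ∧
    Nat.card SignTuple = 62 ∧
    Nat.card SignOrbits = 8 ∧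
    -- there are exactly eight quasi-Euclidean classes of maximal alcoved polyhedra, and they
    -- correspond to the orbits through the signs of the difference tuple
    Nat.card (Quotient quasiEuclidean) = 8 ∧
    (∃ e : Quotient quasiEuclidean ≃ SignOrbits,
      ∀ (P : maximalAlcoved) (A : Matrix (Fin 4) (Fin 4) ℝ) (s : SignTuple),
        Represents A P → HasSigns A s → e (Quotient.mk _ P) = orbitOf s) ∧
    -- the same holds inside the family of those whose bounding box is the cube, with
    -- perturbations inside this family
    Nat.card (Quotient (cubeEquiv maximalInCube)) = 8 ∧
    (∃ e : Quotient (cubeEquiv maximalInCube) ≃ SignOrbits,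
      ∀ (P : maximalInCube) (A : Matrix (Fin 4) (Fin 4) ℝ) (s : SignTuple),
        Represents A P → HasSigns A s → e (Quotient.mk _ P) = orbitOf s) := by
  refine ⟨isGreatest_fVec,
    fun P hP => ⟨(mem_maximalAlcoved_iff_fVec.1 hP).2, isSimple_of_mem_maximalAlcoved hP⟩,
    fun P hP => existsUnique_represents hP, fun P hP A hA => exists_hasSigns hP hA,
    ⟨signEquiv, signHom_neg_one, signHom_swap_zero_one, signHom_swap_zero_two,
      signHom_swap_one_two⟩,
    card_signTuple, card_signOrbits, ?_, exists_equiv_quasiEuclidean, ?_,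
    exists_equiv_maximalInCube⟩
  · obtain ⟨e, -⟩ := exists_equiv_quasiEuclidean
    rw [Nat.card_congr e, card_signOrbits]
  · obtain ⟨e, -⟩ := exists_equiv_maximalInCube
    rw [Nat.card_congr e, card_signOrbits]
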